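/- **Conventions.** For an integer $p\ge 1$ and $a>0$ let $k_p(\tau;a)$ be the unit-variance Matérn kernel of smoothness $\nu=p-\tfrac12$ and decay rate $a$ (length-scale $\sqrt{2\nu}/a$), i.e. $$k_p(\tau;a)=e^{-a|\tau|}\,\frac{(p-1)!}{(2p-2)!}\sum_{l=0}^{p-1}\frac{(p-1+l)!}{l!\,(p-1-l)!}\,(2a|\tau|)^{p-1-l}.$$ For $b\in\mathbb R$ the Hida-Matérn kernel of order $p$ is $\cos(b\tau)\,k_p(\tau;a)=\operatorname{Re} z_{p}(\tau;a,b)$ with $z_{p}(\tau;a,b)=e^{ib\tau}k_p(\tau;a)$, and its state covariance is the complex $p\times p$ matrix $$K^S_p(\tau;a,b)=\big[(-1)^j\,z_{p}^{(i+j)}(\tau;a,b)\big]_{0\le i,j\le p-1}.$$ A Hida-Matérn mixture consists of finitely many mixands $(p_i,a_i,b_i,c_i)$, $i=1,\dots,m$, with $p_i\ge1$, $a_i>0$, $b_i\in\mathbb R$, $c_i>0$. The state-space model of the mixture has the block diagonal state covariance $K^S(\tau)=\operatorname{diag}\big(c_iK^S_{p_i}(\tau;a_i,b_i)\big)_{i\le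 m}$ and, for $\tau\ge0$, the state-transition matrix $A(\tau)=K^S(\tau)K^S(0)^{-1}$. The mixture is said to match a complex Jordan matrix if there is a bijection between its mixands and the Jordan blocks under which mixand $i$ corresponds to a block of size $p_i$ with eigenvalue $-a_i+\mathrm{i}\,b_i$. **Statement.** Let $F\in\mathbb R^{N\times N}$ be stable (every complex eigenvalue has negative real part) and let $L\in\mathbb R^{N\times M}$. Then $F$ has a complex Jordan form, and for every complex Jordan form $J$ of $F$ the following hold. 1. There is a Hida-Matérn mixture that matches $J$. For every such mixture, $\sum_i p_i=N$, and $K^S(\tau)$ is invertible for all $\tau\ge 0$. 2. A Hida-Matérn mixture matches $J$ if and only if there is an invertible complex matrix $X$ with $$\exp(F\tau)=X\,K^S(\tau)\,K^S(0)^{-1}X^{-1}\qquad\text{for all }\tau\ge 0 .$$ Thus the Jordan blocks of $F$ fix the number of mixands and their orders, and the eigenvalues of the blocks fix the hyperparameters $a_i,b_i$; the weights $c_i>0$ are arbitrary. 3. Let a mixture and an $X$ be as in item 2. Let $W$ be an $M$-dimensional standard Brownian motion on a probability space and let $f$ be a solution of $df=Ff\,dt+L\,dW$ on $[0,\infty)$: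 $f$ has almost surely continuous paths, $f(0)$ is independent of $W$, and almost surely $f(t)=f(0)+\int_0^tFf(u)\,du+L\,W(t)$ for all $t\ge0$. Then in the coordinates $g=X^{-1}f$ the process follows a linear Gaussian state-space model whose transition matrix is that of the mixture: for all $0\le s\le t$, $$g(t)=K^S(t-s)\,K^S(0)^{-1}\,g(s)+X^{-1}\eta ,$$ where the $\mathbb R^N$-valued random vector $\eta$ is independent of $(f(u))_{u\le s}$ and has the normal distribution with mean $0$ and (positive semidefinite) covariance matrix $\int_0^{t-s}e^{uF}LL^{\top}e^{uF^{\top}}du$. -/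

import Mathlib

open MeasureTheory ProbabilityTheory
open scoped NNReal Matrix

noncomputable section

namespace HidaMatern

/-! ### Jordan form -/

/-- The `n × n` Jordan block with eigenvalue `ev`: `ev` on the diagonal, `1` just above it. -/
def jordanBlock (ev : ℂ) (n : ℕ) : Matrix (Fin n) (Fin n) ℂ :=
  Matrix.of fun i j => if i = j then ev else if (i : ℕ) + 1 = j then 1 else 0

/-- A finite list of (nonempty) Jordan blocks. -/
structure JordanData where
  numBlocks : ℕ
  size : Fin numBlocks → ℕ
  size_pos : ∀ i, 0 < size i
  ev : Fin numBlocks → ℂ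

/-- The Jordan matrix `J`, block diagonal with the given Jordan blocks. -/
def JordanData.matrix (B : JordanData) :
    Matrix (Σ i, Fin (B.size i)) (Σ i, Fin (B.size i)) ℂ :=
  Matrix.blockDiagonal' fun i => jordanBlock (B.ev i) (B.size i)

/-- A real matrix regarded as a complex one. -/
def toComplex {m n : Type*} (A : Matrix m n ℝ) : Matrix m n ℂ :=
  A.map Complex.ofReal

/-- `F = C J C⁻¹` over `ℂ`, with `C⁻¹` written as a two-sided inverse `D`, because `J` is indexed
by pairs (block, position in the block). -/
def IsJordanForm {N : ℕ} (F : Matrix (Fin N) (Fin N) ℝ) (B : JordanData) : Prop :=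
  ∃ (C : Matrix (Fin N) (Σ i, Fin (B.size i)) ℂ) (D : Matrix (Σ i, Fin (B.size i)) (Fin N) ℂ),
    C * D = 1 ∧ D * C = 1 ∧ toComplex F = C * B.matrix * D

/-- `F` is stable (Hurwitz): every complex eigenvalue has negative real part. -/
def IsStable {N : ℕ} (F : Matrix (Fin N) (Fin N) ℝ) : Prop :=
  ∀ z ∈ spectrum ℂ (toComplex F), z.re < 0

/-! ### Hida-Matérn kernels -/

/-- The unit-variance Matérn kernel of order `p ≥ 1` with decay rate `a`, in closed form; its
smoothness is `ν = p - 1/2` and its length-scale is `√(2ν) / a`. With `q = p - 1` it equals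
`exp(-a|τ|) * (q! / (2q)!) * ∑_{l ≤ q} (q+l)! / (l! (q-l)!) * (2a|τ|)^(q-l)`. -/
def maternKernel (p : ℕ) (a τ : ℝ) : ℝ :=
  Real.exp (-a * |τ|) * (((p - 1).factorial : ℝ) / ((2 * (p - 1)).factorial : ℝ)) *
    ∑ l ∈ Finset.range p,
      ((p - 1 + l).factorial : ℝ) / ((l.factorial : ℝ) * ((p - 1 - l).factorial : ℝ)) *
        (2 * a * |τ|) ^ (p - 1 - l)

/-- The real Hida-Matérn kernel `k_{H,p}(τ; a, b) = cos(bτ) k_Mat(τ)` of order `p`. -/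
def hidaMaternKernel (p : ℕ) (a b τ : ℝ) : ℝ :=
  Real.cos (b * τ) * maternKernel p a τ

/-- The complex Hida-Matérn kernel `k_z(τ; a, b) = exp(ibτ) k_{H,p}(τ; a, 0)`, from which the
`p`-dimensional state-space model of the Hida-Matérn kernel is built. -/
def complexHidaMaternKernel (p : ℕ) (a b τ : ℝ) : ℂ :=
  Complex.exp (Complex.I * ((b * τ : ℝ) : ℂ)) * ((hidaMaternKernel p a 0 τ : ℝ) : ℂ)

theorem re_complexHidaMaternKernel (p : ℕ) (a b τ : ℝ) :
    (complexHidaMaternKernel p a b τ).re = hidaMaternKernel p a b τ := by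
  simp only [complexHidaMaternKernel, hidaMaternKernel]
  rw [Complex.re_mul_ofReal, mul_comm Complex.I, Complex.exp_ofReal_mul_I_re]
  simp

/-- The covariance matrix at lag `τ` of `(z, z', …, z^{(p-1)})` (mean-square derivatives) for a GP
`z` with complex Hida-Matérn kernel `k`: its `(i, j)` entry is `(-1)^j k^{(i+j)}(τ)`. Here
`k` is `2p - 2` times differentiable at `0`, so no derivative below is a default value. -/
def stateCov (p : ℕ) (a b τ : ℝ) : Matrix (Fin p) (Fin p) ℂ :=
  Matrix.of fun i j =>
    (-1) ^ (j : ℕ) * iteratedDeriv ((i : ℕ) + (j : ℕ)) (complexHidaMaternKernel p a b) τ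

/-- The hyperparameters of a Hida-Matérn mixture: finitely many mixands, each with an order
`p i ≥ 1`, an inverse length-scale (decay rate) `a i > 0`, a frequency `b i` and a weight
`c i > 0`. -/
structure Mixture where
  numMixands : ℕ
  order : Fin numMixands → ℕ
  order_pos : ∀ i, 0 < order i
  decay : Fin numMixands → ℝ
  decay_pos : ∀ i, 0 < decay i
  freq : Fin numMixands → ℝ
  weight : Fin numMixands → ℝ
  weight_pos : ∀ i, 0 < weight i

namespace Mixture

/-- The real mixture kernel `∑ c i * k_{H, p i}(τ; a i, b i)`. -/
def kernel (K : Mixture) (τ : ℝ) : ℝ :=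
  ∑ i, K.weight i * hidaMaternKernel (K.order i) (K.decay i) (K.freq i) τ

/-- The index set of the state: a mixand and the order of a derivative of it. -/
abbrev State (K : Mixture) : Type := Σ i, Fin (K.order i)

/-- The mixture's `K^S(τ)`, block diagonal with blocks `c i * K^S_{H, p i}(τ)`. -/
def cov (K : Mixture) (τ : ℝ) : Matrix K.State K.State ℂ :=
  Matrix.blockDiagonal' fun i =>
    ((K.weight i : ℝ) : ℂ) • stateCov (K.order i) (K.decay i) (K.freq i) τ

/-- The state-transition matrix `A(τ) = K^S(τ) K^S(0)⁻¹` of the state-space model. -/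
def transition (K : Mixture) (τ : ℝ) : Matrix K.State K.State ℂ :=
  K.cov τ * (K.cov 0)⁻¹

/-- The mixands correspond bijectively to the Jordan blocks: the order of a mixand is the size of
its block, and the eigenvalue of the block is `-a + i b`. -/
def Matches (K : Mixture) (B : JordanData) : Prop :=
  ∃ e : Fin K.numMixands ≃ Fin B.numBlocks, ∀ i,
    B.size (e i) = K.order i ∧ B.ev (e i) = ⟨-K.decay i, K.freq i⟩

/-- `X`, with inverse `Y`, is a linear change of coordinates of the state that turns the
dynamics of the state-space model of the mixture into those of `df = F f dt + L dW`:
`exp(τF) = X K^S(τ) K^S(0)⁻¹ X⁻¹` for all lags `τ ≥ 0`. -/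
def IsCoordinateChange {N : ℕ} (F : Matrix (Fin N) (Fin N) ℝ) (K : Mixture)
    (X : Matrix (Fin N) K.State ℂ) (Y : Matrix K.State (Fin N) ℂ) : Prop :=
  X * Y = 1 ∧ Y * X = 1 ∧
    ∀ τ : ℝ, 0 ≤ τ → NormedSpace.exp ((τ : ℂ) • toComplex F) = X * K.transition τ * Y

end Mixture

/-! ### Linear stochastic differential equations -/

/-- `W` is an `M`-dimensional standard Brownian motion: its coordinates are independent real
Brownian motions. -/
structure IsBrownianVector {Ω : Type*} [MeasurableSpace Ω] {M : ℕ}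
    (W : ℝ≥0 → Ω → Fin M → ℝ) (P : Measure Ω) : Prop where
  measurable : ∀ t, Measurable (W t)
  coord : ∀ i, IsBrownianReal (fun t ω => W t ω i) P
  indep : iIndepFun (fun (i : Fin M) (ω : Ω) (t : ℝ≥0) => W t ω i) P

/-- `f` solves `df = F f dt + L dW`: it has continuous paths, its initial value is
independent of the Brownian motion, and almost surely
`f(t) = f(0) + ∫₀ᵗ F f(u) du + L W(t)` for all `t ≥ 0`. (The noise is additive, so the stochastic
integral is `L W(t)`.) -/
structure IsSolution {Ω : Type*} [MeasurableSpace Ω] {N M : ℕ}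
    (F : Matrix (Fin N) (Fin N) ℝ) (L : Matrix (Fin N) (Fin M) ℝ)
    (W : ℝ≥0 → Ω → Fin M → ℝ) (f : ℝ≥0 → Ω → Fin N → ℝ) (P : Measure Ω) : Prop where
  measurable : ∀ t, Measurable (f t)
  continuous : ∀ᵐ ω ∂P, Continuous fun t => f t ω
  indep_init : IndepFun (f 0) (fun ω t => W t ω) P
  eq : ∀ᵐ ω ∂P, ∀ t : ℝ≥0,
    f t ω = f 0 ω + (∫ u in (0 : ℝ)..t, F *ᵥ f u.toNNReal ω) + L *ᵥ W t ω

/-- The covariance `∫₀^τ exp(uF) L Lᵀ exp(uF)ᵀ du` of the noise `∫₀^τ exp((τ-u)F) L dW(u)`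
that the SDE accumulates over a time `τ`. -/
def noiseCov {N M : ℕ} (F : Matrix (Fin N) (Fin N) ℝ) (L : Matrix (Fin N) (Fin M) ℝ) (τ : ℝ) :
    Matrix (Fin N) (Fin N) ℝ :=
  Matrix.of fun i j => ∫ u in (0 : ℝ)..τ,
    (NormedSpace.exp (u • F) * L * Lᵀ * (NormedSpace.exp (u • F))ᵀ) i j

/-- A state vector with real entries regarded as a complex one. -/
def vecToComplex {n : Type*} (v : n → ℝ) : n → ℂ := fun i => (v i : ℂ)

/-- In the coordinates `g = Y f`, the process `f` follows a linear Gaussian state-space model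
with transition matrix `A`: for `s ≤ t`, `g(t) = A(t-s) g(s) + Y η`, where `η` is independent of
the past `(f(u))_{u ≤ s}` and is normally distributed with mean `0` and covariance `Q(t-s)`. -/
def FollowsSSM {Ω : Type*} [MeasurableSpace Ω] {N : ℕ} {S : Type*} [Fintype S]
    (A : ℝ → Matrix S S ℂ) (Q : ℝ → Matrix (Fin N) (Fin N) ℝ) (Y : Matrix S (Fin N) ℂ)
    (f : ℝ≥0 → Ω → Fin N → ℝ) (P : Measure Ω) : Prop :=
  ∀ s t : ℝ≥0, s ≤ t → ∃ η : Ω → Fin N → ℝ,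
    (∀ ω, Y *ᵥ vecToComplex (f t ω) =
      A (t - s) *ᵥ (Y *ᵥ vecToComplex (f s ω)) + Y *ᵥ vecToComplex (η ω)) ∧
    IndepFun η (fun ω (u : Set.Iic s) => f u ω) P ∧
    (Q (t - s)).PosSemidef ∧
    HasLaw (fun ω => WithLp.toLp 2 (η ω)) (multivariateGaussian 0 (Q (t - s))) P

end HidaMatern

end

/-!
The whole argument rests on one factorization. For `τ ≥ 0` the complex Hida-Matérn kernel of order
`p` is `exp (c τ) q(τ)` with `c = -a + i b` and `q` a polynomial of degree `p - 1`, so its state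
vector solves a linear differential equation whose generator, read in the derivatives of `q`, is the
Jordan block of size `p` with eigenvalue `c`. This gives `K^S(τ) = O exp(τ J) R` with constant
invertible `O` and `R` (`stateCov_eq`), hence `K^S(τ) K^S(0)⁻¹ = O exp(τ J) O⁻¹`
(`Mixture.exists_transition_eq`) with `J` the Jordan matrix that the mixture matches; the weights
cancel. The formula includes `τ = 0`, where the state covariance contains derivatives of order up to
`2p - 2` at the corner of `|τ|`: these exist because the odd derivatives of the Matérn kernel at `0⁺`
vanish below that order, by a recursion coming from its differential equation (`matern_deriv_odd`).

A mixture matching a Jordan form of `F` therefore has transition matrices similar to `exp(τ F)`.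
Conversely, taking the right derivative at `τ = 0` of `exp(τ F) = X A(τ) X⁻¹` shows that `F` is
similar to the Jordan matrix of the mixture, and the uniqueness of the Jordan form
(`JordanData.exists_equiv_of_similar`, by counting ranks of powers of `J - μ`) gives the matching.
Existence of the Jordan form (`exists_isJordanForm`) comes from the structure theorem of finitely
generated torsion modules over `ℂ[X]`.

For the differential equation the noise is forced to be `η = f(t) - exp((t - s) F) f(s)`. Variation
of constants and summation by parts show, path by path, that `η` is the limit of the Riemann sums of
the Wiener integral `∫ exp((t - u) F) L dW(u)` (`IsSolution.tendsto_noiseSum`). So `η` is a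
function of the increments of `W` after `s`, while `f(u)` for `u ≤ s` is a function of `f(0)` and
of `W` up to time `s`, and independence follows from the weak Markov property
(`IsSolution.indepFun_noise`). The characteristic functions of the Riemann sums are explicit Gaussian
ones, and they converge to that of the normal distribution with covariance `noiseCov`
(`IsSolution.hasLaw_noise`).
-/


noncomputable section

namespace HidaMatern

/-! ### Exponential polynomials and gluing at the origin -/

section

open Polynomial

/-- The operator `D + c` on polynomials; differentiating `exp (c τ) q(τ)` amounts to applying it
to `q`. -/
def shiftedDerivative (c : ℂ) : Module.End ℂ ℂ[X] := derivative + c • 1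

/-- The exponential polynomial `τ ↦ exp (c τ) q(τ)` on the real line. -/
def expPoly (c : ℂ) (q : ℂ[X]) (τ : ℝ) : ℂ := Complex.exp (c * τ) * q.eval (τ : ℂ)

theorem shiftedDerivative_apply (c : ℂ) (q : ℂ[X]) :
    shiftedDerivative c q = derivative q + C c * q := by
  rw [shiftedDerivative, LinearMap.add_apply, LinearMap.smul_apply, Module.End.one_apply,
    smul_eq_C_mul]

theorem hasDerivAt_expPoly (c : ℂ) (q : ℂ[X]) (τ : ℝ) :
    HasDerivAt (expPoly c q) (expPoly c (shiftedDerivative c q) τ) τ := by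
  have h : HasDerivAt (fun z : ℂ => Complex.exp (c * z) * q.eval z)
      (Complex.exp (c * τ) * (shiftedDerivative c q).eval (τ : ℂ)) (τ : ℂ) := by
    have h1 : HasDerivAt (fun z : ℂ => Complex.exp (c * z)) (Complex.exp (c * τ) * c) (τ : ℂ) := by
      simpa using ((hasDerivAt_id (τ : ℂ)).const_mul c).cexp
    refine (h1.mul (q.hasDerivAt (τ : ℂ))).congr_deriv ?_
    rw [shiftedDerivative_apply, eval_add, eval_mul, eval_C]
    ring
  exact h.comp_ofReal

/-- Binomial expansion of `(D + (c + d))^m` in powers of `D + c`, evaluated at a point. -/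
theorem eval_shiftedDerivative_add_pow (c d x : ℂ) (m : ℕ) (q : ℂ[X]) :
    ((shiftedDerivative (c + d) ^ m) q).eval x =
      ∑ k ∈ Finset.range (m + 1),
        ((shiftedDerivative c ^ k) q).eval x * d ^ (m - k) * m.choose k := by
  have h : shiftedDerivative (c + d) = shiftedDerivative c + d • 1 := by
    simp only [shiftedDerivative, add_smul, add_assoc]
  have hc : Commute (shiftedDerivative c) (d • (1 : Module.End ℂ ℂ[X])) :=
    (Commute.one_right _).smul_right d
  rw [h, hc.add_pow, LinearMap.sum_apply, eval_finsetSum]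
  refine Finset.sum_congr rfl fun k _ => ?_
  rw [_root_.smul_pow, one_pow, mul_smul_comm, mul_one, ← nsmul_eq_mul', LinearMap.smul_apply,
    LinearMap.smul_apply, eval_smul, eval_smul, nsmul_eq_mul, smul_eq_mul]
  ring

theorem shiftedDerivative_pow_X_mul (c : ℂ) (m : ℕ) (q : ℂ[X]) :
    (shiftedDerivative c ^ (m + 1)) (X * q) =
      X * (shiftedDerivative c ^ (m + 1)) q + (m + 1 : ℂ[X]) * (shiftedDerivative c ^ m) q := by
  induction m with
  | zero => simp [shiftedDerivative_apply]; ring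
  | succ m ih =>
    rw [pow_succ' _ (m + 1), Module.End.mul_apply, ih]
    have h2 : (shiftedDerivative c ^ (m + 1)) q
        = shiftedDerivative c ((shiftedDerivative c ^ m) q) := by
      rw [pow_succ', Module.End.mul_apply]
    rw [Module.End.mul_apply, h2]
    simp [shiftedDerivative_apply]
    ring

theorem shiftedDerivative_pow_comp_neg_X (c : ℂ) (m : ℕ) (q : ℂ[X]) :
    (shiftedDerivative (-c) ^ m) (q.comp (-X)) =
      (-1) ^ m * ((shiftedDerivative c ^ m) q).comp (-X) := by
  induction m with
  | zero => simp
  | succ m ih =>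
    rw [pow_succ', Module.End.mul_apply, ih, pow_succ' (shiftedDerivative c), Module.End.mul_apply]
    have h : derivative ((-1 : ℂ[X]) ^ m) = 0 := by
      rw [← C_1, ← C_neg, ← C_pow, derivative_C]
    simp [shiftedDerivative_apply, derivative_comp, h]
    ring

/-- Gluing at `0` two smooth functions, given with their successive derivatives `G₁ m` and `G₂ m`,
whose first `n` derivatives agree at `0`, yields an `n` times differentiable function. -/
theorem iteratedDeriv_glue {z : ℝ → ℂ} {G₁ G₂ : ℕ → ℝ → ℂ} {n : ℕ}
    (h₁ : ∀ m τ, HasDerivAt (G₁ m) (G₁ (m + 1) τ) τ)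
    (h₂ : ∀ m τ, HasDerivAt (G₂ m) (G₂ (m + 1) τ) τ)
    (hz₁ : ∀ τ, 0 ≤ τ → z τ = G₁ 0 τ) (hz₂ : ∀ τ, τ ≤ 0 → z τ = G₂ 0 τ)
    (h0 : ∀ m ≤ n, G₁ m 0 = G₂ m 0) {m : ℕ} (hm : m ≤ n) :
    (∀ τ, 0 ≤ τ → iteratedDeriv m z τ = G₁ m τ) ∧
      ∀ τ, τ ≤ 0 → iteratedDeriv m z τ = G₂ m τ := by
  induction m with
  | zero => simpa using ⟨hz₁, hz₂⟩
  | succ m ih =>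
    obtain ⟨ih₁, ih₂⟩ := ih (by omega)
    have hpos : ∀ τ, 0 < τ → iteratedDeriv (m + 1) z τ = G₁ (m + 1) τ := fun τ hτ => by
      rw [iteratedDeriv_succ]
      refine ((h₁ m τ).congr_of_eventuallyEq ?_).deriv
      filter_upwards [lt_mem_nhds hτ] with x hx using ih₁ x hx.le
    have hneg : ∀ τ, τ < 0 → iteratedDeriv (m + 1) z τ = G₂ (m + 1) τ := fun τ hτ => by
      rw [iteratedDeriv_succ]
      refine ((h₂ m τ).congr_of_eventuallyEq ?_).deriv
      filter_upwards [gt_mem_nhds hτ] with x hx using ih₂ x hx.le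
    have hzero : iteratedDeriv (m + 1) z 0 = G₁ (m + 1) 0 := by
      rw [iteratedDeriv_succ]
      have hr : HasDerivWithinAt (iteratedDeriv m z) (G₁ (m + 1) 0) (Set.Ici 0) 0 :=
        (h₁ m 0).hasDerivWithinAt.congr (fun x hx => ih₁ x hx) (ih₁ 0 le_rfl)
      have hl : HasDerivWithinAt (iteratedDeriv m z) (G₁ (m + 1) 0) (Set.Iic 0) 0 := by
        rw [h0 (m + 1) hm]
        exact (h₂ m 0).hasDerivWithinAt.congr (fun x hx => ih₂ x hx) (ih₂ 0 le_rfl)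
      have := hl.union hr
      rw [Set.Iic_union_Ici, hasDerivWithinAt_univ] at this
      exact this.deriv
    refine ⟨fun τ hτ => ?_, fun τ hτ => ?_⟩
    · rcases hτ.eq_or_lt with rfl | hτ
      · exact hzero
      · exact hpos τ hτ
    · rcases hτ.eq_or_lt with rfl | hτ
      · rw [hzero, h0 (m + 1) hm]
      · exact hneg τ hτ

end

/-! ### Derivatives of the Matérn kernel -/

section

open Polynomial

/-- The coefficient of `τ ^ k` in the polynomial factor of the Matérn kernel of order `n + 1`. -/
def maternCoeff (n : ℕ) (a : ℝ) (k : ℕ) : ℂ :=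
  (n.factorial : ℂ) / (2 * n).factorial *
    ((2 * n - k).factorial / ((n - k).factorial * k.factorial) * (2 * a) ^ k)

/-- The polynomial factor of the Matérn kernel of order `n + 1`, a reverse Bessel polynomial. -/
def maternPoly (n : ℕ) (a : ℝ) : ℂ[X] :=
  ∑ k ∈ Finset.range (n + 1), monomial k (maternCoeff n a k)

theorem coeff_maternPoly (n : ℕ) (a : ℝ) (k : ℕ) :
    (maternPoly n a).coeff k = if k ≤ n then maternCoeff n a k else 0 := by
  simp [maternPoly, coeff_monomial]

theorem maternKernel_eq (n : ℕ) (a τ : ℝ) :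
    (maternKernel (n + 1) a τ : ℂ) =
      Complex.exp (-a * |τ|) * (maternPoly n a).eval ((|τ| : ℝ) : ℂ) := by
  rw [maternPoly, eval_finsetSum, ← Finset.sum_range_reflect, maternKernel]
  push_cast
  rw [mul_assoc, Finset.mul_sum]
  congr 1
  refine Finset.sum_congr rfl fun l hl => ?_
  have hl : l ≤ n := Nat.lt_succ_iff.1 (Finset.mem_range.1 hl)
  have e2 : 2 * n - (n - l) = n + l := by omega
  have e3 : n - (n - l) = l := by omega
  simp only [eval_monomial, maternCoeff, e2, e3]
  rw [mul_pow (2 * (a : ℂ))]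
  ring

/-- Consecutive Matérn coefficients satisfy a two-term recursion. -/
theorem maternCoeff_succ {n k : ℕ} (a : ℝ) (hk : k < n) :
    ((k : ℂ) + 1) * (2 * n - k) * maternCoeff n a (k + 1) =
      2 * a * (n - k) * maternCoeff n a k := by
  obtain ⟨r, rfl⟩ : ∃ r, n = k + 1 + r := ⟨n - (k + 1), by omega⟩
  have e1 : 2 * (k + 1 + r) - (k + 1) = k + 1 + 2 * r := by omega
  have e2 : 2 * (k + 1 + r) - k = (k + 1 + 2 * r) + 1 := by omega
  have e3 : k + 1 + r - (k + 1) = r := by omega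
  have e4 : k + 1 + r - k = r + 1 := by omega
  simp only [maternCoeff, e1, e2, e3, e4, Nat.factorial_succ (k + 1 + 2 * r),
    Nat.factorial_succ r, Nat.factorial_succ k]
  have h1 : ((2 * (k + 1 + r)).factorial : ℂ) ≠ 0 := by exact_mod_cast Nat.factorial_ne_zero _
  have h2 : (r.factorial : ℂ) ≠ 0 := by exact_mod_cast Nat.factorial_ne_zero _
  have h3 : (k.factorial : ℂ) ≠ 0 := by exact_mod_cast Nat.factorial_ne_zero _
  have h4 : (r : ℂ) + 1 ≠ 0 := by exact_mod_cast Nat.succ_ne_zero r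
  have h5 : (k : ℂ) + 1 ≠ 0 := by exact_mod_cast Nat.succ_ne_zero k
  push_cast
  field_simp
  ring

/-- The differential equation `τ k'' - 2 n k' = a² τ k` of the Matérn kernel, in terms of its
polynomial factor. -/
theorem maternPoly_ode (n : ℕ) (a : ℝ) :
    X * (shiftedDerivative (-a) ^ 2) (maternPoly n a) =
      C (2 * n : ℂ) * shiftedDerivative (-a) (maternPoly n a) +
        C ((a : ℂ) ^ 2) * (X * maternPoly n a) := by
  have key : X * derivative (derivative (maternPoly n a)) +
      C (2 * n * a : ℂ) * maternPoly n a =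
      C (2 * a : ℂ) * (X * derivative (maternPoly n a)) +
        C (2 * n : ℂ) * derivative (maternPoly n a) := by
    ext k
    have h : ((k : ℂ) + 1) * (2 * n - k) * (maternPoly n a).coeff (k + 1) =
        2 * a * (n - k) * (maternPoly n a).coeff k := by
      simp only [coeff_maternPoly]
      rcases lt_trichotomy k n with hk | rfl | hk
      · rw [if_pos (by omega), if_pos hk.le, maternCoeff_succ a hk]
      · simp
      · rw [if_neg (by omega), if_neg (by omega)]; simp
    rcases k with _ | k
    · simp only [coeff_add, mul_coeff_zero, coeff_X_zero, coeff_derivative]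
      simp at h ⊢
      linear_combination -h
    · simp only [coeff_add, coeff_C_mul, coeff_X_mul, coeff_derivative]
      push_cast at h ⊢
      linear_combination -h
  rw [pow_two, Module.End.mul_apply]
  simp only [shiftedDerivative_apply, derivative_add, derivative_mul, derivative_C]
  simp only [map_neg, map_mul, map_pow] at key ⊢
  have h2 : (C 2 : ℂ[X]) = 2 := rfl
  rw [h2] at key ⊢
  linear_combination key

/-- The derivatives of the Matérn kernel of order `n + 1` at `0⁺` satisfy a two-step recursion:
differentiate its differential equation `m + 1` times at `0`. -/
theorem matern_deriv_rec (n : ℕ) (a : ℝ) (m : ℕ) :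
    ((m : ℂ) + 1 - 2 * n) *
        ((shiftedDerivative (-a) ^ (m + 2)) (maternPoly n a)).eval 0 =
      (a : ℂ) ^ 2 * (m + 1) * ((shiftedDerivative (-a) ^ m) (maternPoly n a)).eval 0 := by
  have h := congrArg (fun r => ((shiftedDerivative (-a) ^ (m + 1)) r).eval 0) (maternPoly_ode n a)
  simp only [shiftedDerivative_pow_X_mul, map_add, ← smul_eq_C_mul, map_smul] at h
  simp only [eval_add, eval_mul, eval_X, zero_mul, zero_add, eval_smul, smul_eq_mul, eval_natCast,
    eval_one, ← Module.End.mul_apply, ← pow_add, ← pow_succ] at h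
  linear_combination h

/-- The odd derivatives of the Matérn kernel at `0⁺` vanish below order `2 n`. -/
theorem matern_deriv_odd (n : ℕ) (a : ℝ) {r : ℕ} (hr : r < n) :
    ((shiftedDerivative (-a) ^ (2 * r + 1)) (maternPoly n a)).eval 0 = 0 := by
  induction r with
  | zero =>
    -- the differential equation itself, evaluated at `0`
    have h := congrArg (fun r => r.eval 0) (maternPoly_ode n a)
    simp only [eval_mul, eval_X, zero_mul, eval_add, mul_zero, add_zero, eval_C] at h
    have hn : (2 * n : ℂ) ≠ 0 := by
      have : (n : ℂ) ≠ 0 := by exact_mod_cast hr.ne'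
      simpa using this
    simpa using (mul_eq_zero.1 h.symm).resolve_left hn
  | succ r ih =>
    have h := matern_deriv_rec n a (2 * r + 1)
    rw [ih (by omega), mul_zero] at h
    -- the factor `2 r + 2 - 2 n` does not vanish since `r + 1 < n`
    refine (mul_eq_zero.1 h).resolve_left ?_
    rw [sub_eq_zero]
    norm_cast
    omega

/-- The two exponential polynomials that represent the complex Hida-Matérn kernel on either side of
`0` have the same derivatives at `0` up to order `2 n`. -/
theorem matern_deriv_reflect (n : ℕ) (a b : ℝ) {m : ℕ} (hm : m ≤ 2 * n) :
    ((shiftedDerivative (-a + Complex.I * b) ^ m) (maternPoly n a)).eval 0 =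
      ((shiftedDerivative (a + Complex.I * b) ^ m) ((maternPoly n a).comp (-X))).eval 0 := by
  simp only [eval_shiftedDerivative_add_pow]
  refine Finset.sum_congr rfl fun k hk => ?_
  have hk : k ≤ 2 * n := (Nat.lt_succ_iff.1 (Finset.mem_range.1 hk)).trans hm
  congr 2
  have h := shiftedDerivative_pow_comp_neg_X (-a) k (maternPoly n a)
  rw [neg_neg] at h
  rw [h]
  rcases Nat.even_or_odd' k with ⟨r, rfl | rfl⟩
  · simp
  · rw [matern_deriv_odd n a (by omega)]
    simp [matern_deriv_odd n a (show r < n by omega)]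

theorem iteratedDeriv_complexHidaMaternKernel (n : ℕ) (a b : ℝ) {m : ℕ} (hm : m ≤ 2 * n) {τ : ℝ}
    (hτ : 0 ≤ τ) :
    iteratedDeriv m (complexHidaMaternKernel (n + 1) a b) τ =
      expPoly (-a + Complex.I * b)
        ((shiftedDerivative (-a + Complex.I * b) ^ m) (maternPoly n a)) τ := by
  have hz : ∀ τ : ℝ, complexHidaMaternKernel (n + 1) a b τ =
      Complex.exp (Complex.I * b * τ) *
        (Complex.exp (-a * |τ|) * (maternPoly n a).eval ((|τ| : ℝ) : ℂ)) := fun τ => by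
    rw [← maternKernel_eq, complexHidaMaternKernel, hidaMaternKernel, zero_mul, Real.cos_zero,
      one_mul, Complex.ofReal_mul, mul_assoc]
  refine (iteratedDeriv_glue
    (G₁ := fun m => expPoly (-a + Complex.I * b)
      ((shiftedDerivative (-a + Complex.I * b) ^ m) (maternPoly n a)))
    (G₂ := fun m => expPoly (a + Complex.I * b)
      ((shiftedDerivative (a + Complex.I * b) ^ m) ((maternPoly n a).comp (-X))))
    (n := 2 * n) ?_ ?_ ?_ ?_ ?_ hm).1 τ hτ
  · intro m τ
    rw [pow_succ', Module.End.mul_apply]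
    exact hasDerivAt_expPoly _ _ _
  · intro m τ
    rw [pow_succ', Module.End.mul_apply]
    exact hasDerivAt_expPoly _ _ _
  · intro τ hτ
    rw [hz, abs_of_nonneg hτ, ← mul_assoc, ← Complex.exp_add, expPoly, pow_zero]
    congr 2
    ring
  · intro τ hτ
    rw [hz, abs_of_nonpos hτ, ← mul_assoc, ← Complex.exp_add, expPoly, pow_zero]
    congr 1
    · congr 1; push_cast; ring
    · simp
  · intro m hm
    simpa [expPoly] using matern_deriv_reflect n a b hm

end

/-! ### The state covariance of a Hida-Matérn kernel -/

section

open Polynomial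

section
open scoped Matrix.Norms.Operator

/-- Solutions of the linear matrix differential equation `V' = A V` are `exp (τ A) V(0)`. -/
theorem eq_exp_mul_of_hasDerivAt {n : Type*} [Fintype n] [DecidableEq n] (A : Matrix n n ℂ)
    (V : ℝ → Matrix n n ℂ) (hV : ∀ τ, HasDerivAt V (A * V τ) τ) (τ : ℝ) :
    V τ = NormedSpace.exp ((τ : ℂ) • A) * V 0 := by
  have hE : ∀ τ : ℝ, HasDerivAt (fun τ : ℝ => NormedSpace.exp (τ • (-A)))
      (NormedSpace.exp (τ • (-A)) * (-A)) τ := fun τ => hasDerivAt_exp_smul_const (𝕂 := ℝ) (-A) τ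
  have hW : ∀ τ : ℝ, HasDerivAt (fun τ : ℝ => NormedSpace.exp (τ • (-A)) * V τ) 0 τ := fun τ => by
    refine ((hE τ).mul (hV τ)).congr_deriv ?_
    rw [mul_neg, neg_mul, Matrix.mul_assoc, neg_add_cancel]
  have hc := is_const_of_deriv_eq_zero (fun τ => (hW τ).differentiableAt)
    (fun τ => (hW τ).deriv) τ 0
  simp only [zero_smul, NormedSpace.exp_zero, one_mul] at hc
  have hs : (τ : ℂ) • A = τ • A := by
    ext i j; simp
  rw [hs, ← hc, ← Matrix.mul_assoc, ← Matrix.exp_add_of_commute]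
  · simp
  · rw [smul_neg]
    exact (Commute.refl _).neg_right

end

theorem shiftedDerivative_zero_pow_eq_zero {n : ℕ} {q : ℂ[X]} (hq : q.natDegree < n) :
    (shiftedDerivative 0 ^ n) q = 0 := by
  rw [shiftedDerivative, zero_smul, add_zero, Module.End.pow_apply]
  exact iterate_derivative_eq_zero hq

theorem natDegree_shiftedDerivative_pow_le (c : ℂ) (m : ℕ) (q : ℂ[X]) :
    ((shiftedDerivative c ^ m) q).natDegree ≤ q.natDegree := by
  induction m with
  | zero => simp
  | succ m ih =>
    rw [pow_succ', Module.End.mul_apply, shiftedDerivative_apply]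
    refine (natDegree_add_le _ _).trans (max_le ?_ ?_)
    · exact (natDegree_derivative_le _).trans ((Nat.sub_le _ _).trans ih)
    · exact (natDegree_C_mul_le _ _).trans ih

/-- The change of coordinates from the successive derivatives of a polynomial `q` to those of
`exp (c τ) q(τ)`: row `i` holds the binomial coefficients of `(D + c) ^ i`. -/
def shiftMatrix (c : ℂ) (p : ℕ) : Matrix (Fin p) (Fin p) ℂ :=
  Matrix.of fun i k => c ^ ((i : ℕ) - k) * ((i : ℕ).choose k)

theorem det_shiftMatrix (c : ℂ) (p : ℕ) : (shiftMatrix c p).det = 1 := by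
  rw [Matrix.det_of_isLowerTriangular]
  · simp [shiftMatrix]
  · intro i k hik
    have : (i : ℕ) < k := hik
    simp [shiftMatrix, Nat.choose_eq_zero_of_lt this]

theorem eval_shiftedDerivative_pow (c x : ℂ) {p : ℕ} (i : Fin p) (q : ℂ[X]) :
    ((shiftedDerivative c ^ (i : ℕ)) q).eval x =
      ∑ k : Fin p, shiftMatrix c p i k * ((shiftedDerivative 0 ^ (k : ℕ)) q).eval x := by
  have h := eval_shiftedDerivative_add_pow 0 c x i q
  rw [zero_add] at h
  simp only [shiftMatrix, Matrix.of_apply]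
  rw [h, Fin.sum_univ_eq_sum_range (fun k => c ^ ((i : ℕ) - k) * ((i : ℕ).choose k) *
    ((shiftedDerivative 0 ^ k) q).eval x) p]
  refine (Finset.sum_congr rfl fun k _ => by ring).trans
    (Finset.sum_subset (Finset.range_mono (by omega)) fun k _ hk => ?_)
  rw [Nat.choose_eq_zero_of_lt (by simpa using hk)]
  simp

/-- Column `j` lists, up to the factor `exp (c τ)`, the derivatives at `τ` of the polynomial
factor of the `j`-th derivative of `exp (c τ) q(τ)`. -/
def krylovMatrix (c : ℂ) (q : ℂ[X]) (p : ℕ) (τ : ℝ) : Matrix (Fin p) (Fin p) ℂ :=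
  Matrix.of fun k j => (-1) ^ (j : ℕ) *
    expPoly c ((shiftedDerivative 0 ^ (k : ℕ)) ((shiftedDerivative c ^ (j : ℕ)) q)) τ

theorem jordanBlock_mul_apply (c : ℂ) {p : ℕ} (A : Matrix (Fin p) (Fin p) ℂ) (i j : Fin p) :
    (jordanBlock c p * A) i j =
      c * A i j + if h : (i : ℕ) + 1 < p then A ⟨i + 1, h⟩ j else 0 := by
  rw [Matrix.mul_apply]
  have h1 : ∀ k, jordanBlock c p i k * A k j =
      (if i = k then c * A k j else 0) + if (i : ℕ) + 1 = k then A k j else 0 := fun k => by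
    simp only [jordanBlock, Matrix.of_apply]
    split_ifs with h h' h'
    · exact absurd h' (by rw [h]; omega)
    all_goals simp
  simp only [h1, Finset.sum_add_distrib]
  congr 1
  · simp
  · split_ifs with h
    · rw [Finset.sum_eq_single ⟨i + 1, h⟩]
      · simp
      · intro k _ hk
        rw [if_neg]
        exact fun e => hk (Fin.ext e.symm)
      · simp
    · exact Finset.sum_eq_zero fun k _ => if_neg (by omega)

theorem krylovMatrix_eq_exp_mul (c : ℂ) {q : ℂ[X]} {p : ℕ} (hq : q.natDegree < p) (τ : ℝ) :
    krylovMatrix c q p τ =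
      NormedSpace.exp ((τ : ℂ) • jordanBlock c p) * krylovMatrix c q p 0 := by
  refine eq_exp_mul_of_hasDerivAt _ _ (fun τ => ?_) τ
  refine hasDerivAt_pi.2 fun k => hasDerivAt_pi.2 fun j => ?_
  refine ((hasDerivAt_expPoly c _ τ).const_mul _).congr_deriv ?_
  rw [jordanBlock_mul_apply]
  have h1 : ∀ r : ℂ[X], expPoly c (shiftedDerivative c r) τ =
      c * expPoly c r τ + expPoly c (shiftedDerivative 0 r) τ := fun r => by
    simp [expPoly, shiftedDerivative_apply]
    ring
  have h2 : shiftedDerivative 0 ((shiftedDerivative 0 ^ (k : ℕ)) ((shiftedDerivative c ^ (j : ℕ)) q))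
      = (shiftedDerivative 0 ^ ((k : ℕ) + 1)) ((shiftedDerivative c ^ (j : ℕ)) q) := by
    rw [pow_succ', Module.End.mul_apply]
  rw [h1, h2, mul_add]
  congr 1
  · simp only [krylovMatrix, Matrix.of_apply]; ring
  · split_ifs with h
    · rfl
    · have hk : (k : ℕ) + 1 = p := by omega
      rw [hk, shiftedDerivative_zero_pow_eq_zero
        ((natDegree_shiftedDerivative_pow_le _ _ _).trans_lt hq)]
      simp [expPoly]

/-- At `τ = 0` the matrix `krylovMatrix` is the product of an anti-triangular Hankel matrix, a
unitriangular matrix and a diagonal matrix of signs. -/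
theorem isUnit_det_krylovMatrix_zero (c : ℂ) {q : ℂ[X]} {n : ℕ} (hq : q.natDegree ≤ n)
    (hn : q.coeff n ≠ 0) : IsUnit (krylovMatrix c q (n + 1) 0).det := by
  set H : Matrix (Fin (n + 1)) (Fin (n + 1)) ℂ := Matrix.of fun k l =>
    ((shiftedDerivative 0 ^ ((k : ℕ) + l)) q).eval 0 with hH
  have hcomm : Commute (shiftedDerivative c) (shiftedDerivative 0) := by
    have : shiftedDerivative c = shiftedDerivative 0 + c • 1 := by
      simp [shiftedDerivative]
    rw [this]
    exact (Commute.refl _).add_left ((Commute.one_left _).smul_left c)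
  have hfac : krylovMatrix c q (n + 1) 0 =
      H * (shiftMatrix c (n + 1))ᵀ * Matrix.diagonal fun j : Fin (n + 1) => (-1) ^ (j : ℕ) := by
    ext k j
    have h0 : (shiftedDerivative 0 ^ (k : ℕ)) ((shiftedDerivative c ^ (j : ℕ)) q) =
        (shiftedDerivative c ^ (j : ℕ)) ((shiftedDerivative 0 ^ (k : ℕ)) q) := by
      rw [← Module.End.mul_apply, ← Module.End.mul_apply, (hcomm.pow_pow _ _).eq]
    rw [Matrix.mul_diagonal, Matrix.mul_apply, krylovMatrix, Matrix.of_apply, h0, expPoly,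
      Complex.ofReal_zero, mul_zero, Complex.exp_zero, one_mul, eval_shiftedDerivative_pow,
      mul_comm]
    congr 1
    refine Finset.sum_congr rfl fun l _ => ?_
    rw [Matrix.transpose_apply, hH, Matrix.of_apply, mul_comm, add_comm (k : ℕ), pow_add,
      Module.End.mul_apply]
  have hcoeff : ((shiftedDerivative 0 ^ n) q).eval 0 = n.factorial * q.coeff n := by
    rw [shiftedDerivative, zero_smul, add_zero, Module.End.pow_apply, ← coeff_zero_eq_eval_zero,
      coeff_iterate_derivative, zero_add, Nat.descFactorial_self, nsmul_eq_mul]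
  have hdetH : H.det ≠ 0 := by
    -- reversing the columns turns the Hankel matrix into an upper triangular one
    have htri : (H.submatrix id Fin.revPerm).det ≠ 0 := by
      rw [Matrix.det_of_isUpperTriangular]
      · refine Finset.prod_ne_zero_iff.2 fun i _ => ?_
        have hi : (i : ℕ) + (Fin.rev i : Fin (n + 1)) = n := by rw [Fin.val_rev]; omega
        simp only [Matrix.submatrix_apply, hH, Matrix.of_apply, id, Fin.revPerm_apply, hi, hcoeff]
        exact mul_ne_zero (by exact_mod_cast n.factorial_ne_zero) hn
      · intro i j hij
        have hij : (j : ℕ) < i := hij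
        have : n < (i : ℕ) + (Fin.rev j : Fin (n + 1)) := by rw [Fin.val_rev]; omega
        simp only [Matrix.submatrix_apply, hH, Matrix.of_apply, id, Fin.revPerm_apply]
        rw [shiftedDerivative_zero_pow_eq_zero (hq.trans_lt this), eval_zero]
    rw [Matrix.det_permute'] at htri
    exact right_ne_zero_of_mul htri
  rw [isUnit_iff_ne_zero, hfac, Matrix.det_mul, Matrix.det_mul, Matrix.det_transpose,
    det_shiftMatrix, Matrix.det_diagonal, mul_one]
  refine mul_ne_zero hdetH (Finset.prod_ne_zero_iff.2 fun j _ => ?_)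
  exact pow_ne_zero _ (neg_ne_zero.2 one_ne_zero)

theorem natDegree_maternPoly_le (n : ℕ) (a : ℝ) : (maternPoly n a).natDegree ≤ n :=
  natDegree_le_iff_coeff_eq_zero.2 fun k hk => by rw [coeff_maternPoly, if_neg (by omega)]

theorem coeff_maternPoly_top_ne_zero (n : ℕ) {a : ℝ} (ha : 0 < a) :
    (maternPoly n a).coeff n ≠ 0 := by
  rw [coeff_maternPoly, if_pos le_rfl, maternCoeff]
  have h : ∀ k : ℕ, (k.factorial : ℂ) ≠ 0 := fun k => by exact_mod_cast k.factorial_ne_zero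
  have ha' : (a : ℂ) ≠ 0 := by exact_mod_cast ha.ne'
  simp [h, ha']

/-- The state covariance of a Hida-Matérn kernel of order `p` is, up to constant invertible
factors, the exponential of a Jordan block of size `p` with eigenvalue `-a + i b`. -/
theorem stateCov_eq {p : ℕ} (hp : 0 < p) {a : ℝ} (ha : 0 < a) (b : ℝ) :
    ∃ O R : Matrix (Fin p) (Fin p) ℂ, IsUnit O.det ∧ IsUnit R.det ∧ ∀ τ : ℝ, 0 ≤ τ →
      stateCov p a b τ =
        O * NormedSpace.exp ((τ : ℂ) • jordanBlock (⟨-a, b⟩ : ℂ) p) * R := by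
  obtain ⟨n, rfl⟩ : ∃ n, p = n + 1 := ⟨p - 1, by omega⟩
  have hc : (⟨-a, b⟩ : ℂ) = -a + Complex.I * b := by
    apply Complex.ext <;> simp
  rw [hc]
  set c : ℂ := -a + Complex.I * b
  refine ⟨shiftMatrix c (n + 1), krylovMatrix c (maternPoly n a) (n + 1) 0, ?_, ?_, ?_⟩
  · rw [det_shiftMatrix]; exact isUnit_one
  · exact isUnit_det_krylovMatrix_zero c (natDegree_maternPoly_le n a)
      (coeff_maternPoly_top_ne_zero n ha)
  · intro τ hτ
    rw [Matrix.mul_assoc, ← krylovMatrix_eq_exp_mul c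
      (Nat.lt_succ_of_le (natDegree_maternPoly_le n a))]
    ext i j
    rw [stateCov, Matrix.of_apply, iteratedDeriv_complexHidaMaternKernel n a b (by omega) hτ,
      expPoly, pow_add, Module.End.mul_apply, eval_shiftedDerivative_pow, Matrix.mul_apply,
      Finset.mul_sum, Finset.mul_sum]
    refine Finset.sum_congr rfl fun k _ => ?_
    simp only [krylovMatrix, Matrix.of_apply, expPoly]
    ring

end

/-! ### Existence of the Jordan form -/

section

open Polynomial

/-- The quotient of `ℂ[X]` by a power `p ^ e` of an irreducible polynomial has a basis in which
multiplication by `X` is a Jordan block: with `p` associated to `X - μ`, it consists of the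
classes of the powers of `X - μ`, in decreasing order. -/
theorem exists_jordan_basis_quotient {p : ℂ[X]} (hp : Irreducible p) (e : ℕ) :
    ∃ (μ : ℂ) (b : Module.Basis (Fin e) ℂ (ℂ[X] ⧸ Submodule.span ℂ[X] {p ^ e})),
      ∀ j, (X : ℂ[X]) • b j = μ • b j +
        if h : 0 < (j : ℕ) then b ⟨j - 1, by omega⟩ else 0 := by
  obtain ⟨μ, hμ⟩ : ∃ μ, Associated p (X - C μ) := by
    have h1 := IsAlgClosed.degree_eq_one_of_irreducible ℂ hp
    obtain ⟨μ, hμ⟩ := IsAlgClosed.exists_root p (by rw [h1]; exact one_ne_zero)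
    exact ⟨μ, ((irreducible_X_sub_C μ).associated_of_dvd hp (dvd_iff_isRoot.2 hμ)).symm⟩
  have hspan : Submodule.span ℂ[X] {p ^ e} = Submodule.span ℂ[X] {(X - C μ) ^ e} :=
    Ideal.span_singleton_eq_span_singleton.2 (hμ.pow_pow (n := e))
  rw [hspan]
  let v : Fin e → ℂ[X] ⧸ Submodule.span ℂ[X] {(X - C μ) ^ e} := fun j =>
    Submodule.Quotient.mk ((X - C μ) ^ (e - 1 - j))
  have hli : LinearIndependent ℂ v := by
    rw [Fintype.linearIndependent_iff]
    intro g hg i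
    have h1 : (Submodule.Quotient.mk (∑ j, g j • (X - C μ) ^ (e - 1 - (j : ℕ))) :
        ℂ[X] ⧸ Submodule.span ℂ[X] {(X - C μ) ^ e}) = 0 := by
      rw [← hg, ← Submodule.mkQ_apply, map_sum]
      rfl
    rw [Submodule.Quotient.mk_eq_zero, Submodule.mem_span_singleton] at h1
    obtain ⟨q, hq⟩ := h1
    have h2 := congrArg (fun r : ℂ[X] => (r.comp (X + C μ)).coeff (e - 1 - i)) hq
    simp only [smul_eq_mul, mul_comp, pow_comp, sub_comp, X_comp, C_comp, add_sub_cancel_right,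
      coeff_mul_X_pow', smul_comp, finsetSum_coeff, coeff_smul, coeff_X_pow,
      Polynomial.sum_comp] at h2
    rw [if_neg (by omega), Finset.sum_eq_single i] at h2
    · simpa using h2.symm
    · intro j _ hj
      rw [if_neg (fun h => hj (Fin.ext (by omega))), mul_zero]
    · simp
  have hfin : Module.finrank ℂ (ℂ[X] ⧸ Submodule.span ℂ[X] {(X - C μ) ^ e}) = e := by
    have := finrank_quotient_span_eq_natDegree (f := (X - C μ) ^ e)
    rwa [natDegree_pow, natDegree_X_sub_C, mul_one] at this
  have : FiniteDimensional ℂ (ℂ[X] ⧸ Submodule.span ℂ[X] {(X - C μ) ^ e}) :=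
    ((monic_X_sub_C μ).pow e).finite_adjoinRoot
  refine ⟨μ, Module.Basis.mk hli (hli.span_eq_top_of_card_eq_finrank' (by simp [hfin])).ge, ?_⟩
  intro j
  simp only [Module.Basis.mk_apply, v]
  have hX : ∀ r : ℂ[X], (X : ℂ[X]) • (Submodule.Quotient.mk r :
      ℂ[X] ⧸ Submodule.span ℂ[X] {(X - C μ) ^ e}) =
      μ • Submodule.Quotient.mk r + Submodule.Quotient.mk ((X - C μ) * r) := fun r => by
    rw [← Submodule.Quotient.mk_smul, ← Submodule.Quotient.mk_smul, ← Submodule.Quotient.mk_add,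
      smul_eq_C_mul, smul_eq_mul]
    congr 1
    ring
  rw [hX, ← pow_succ']
  congr 1
  split_ifs with h
  · congr 2
    omega
  · rw [Submodule.Quotient.mk_eq_zero, show e - 1 - (j : ℕ) + 1 = e by omega]
    exact Submodule.mem_span_singleton_self _

/-- Every endomorphism of a finite-dimensional complex vector space has a basis consisting of
Jordan chains. -/
theorem exists_jordan_basis {V : Type*} [AddCommGroup V] [Module ℂ V] [FiniteDimensional ℂ V]
    (f : Module.End ℂ V) :
    ∃ (ι : Type) (_ : Fintype ι) (n : ι → ℕ) (μ : ι → ℂ)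
      (v : Module.Basis (Σ i, Fin (n i)) ℂ V), ∀ i j,
        f (v ⟨i, j⟩) = μ i • v ⟨i, j⟩ +
          if h : 0 < (j : ℕ) then v ⟨i, ⟨j - 1, by omega⟩⟩ else 0 := by
  classical
  obtain ⟨ι, hι, p, hp, e, ⟨E⟩⟩ := Module.equiv_directSum_of_isTorsion
    (Module.AEval.isTorsion_of_finiteDimensional ℂ V f)
  choose μ b hb using fun i => exists_jordan_basis_quotient (hp i) (e i)
  let E' := E.trans (DirectSum.linearEquivFunOnFintype ℂ[X] ι
    (fun i => ℂ[X] ⧸ Submodule.span ℂ[X] {p i ^ e i}))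
  let v := ((Pi.basis b).map (E'.restrictScalars ℂ).symm).map (Module.AEval.of ℂ V f).symm
  have hv : ∀ x, v x = (Module.AEval.of ℂ V f).symm (E'.symm (Pi.basis b x)) := fun _ => rfl
  refine ⟨ι, hι, e, μ, v, fun i j => ?_⟩
  have hf : ∀ y, f ((Module.AEval.of ℂ V f).symm y) =
      (Module.AEval.of ℂ V f).symm ((X : ℂ[X]) • y) := fun y =>
    (Module.AEval.of_symm_X_smul f y).symm
  have hsmul : ∀ (c : ℂ) (y : ∀ i, ℂ[X] ⧸ Submodule.span ℂ[X] {p i ^ e i}),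
      E'.symm (c • y) = c • E'.symm y := (E'.restrictScalars ℂ).symm.map_smul
  have key : (X : ℂ[X]) • Pi.basis b ⟨i, j⟩ = μ i • Pi.basis b ⟨i, j⟩ +
      if h : 0 < (j : ℕ) then Pi.basis b ⟨i, ⟨j - 1, by omega⟩⟩ else 0 := by
    simp only [Pi.basis_apply]
    rw [← Pi.single_smul, hb, Pi.single_add, ← Pi.single_smul]
    congr 1
    split_ifs
    · rfl
    · simp
  rw [hv, hf, ← map_smul E'.symm, key, map_add, map_add, hsmul, map_smul]
  congr 1
  split_ifs
  · rfl
  · simp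

theorem mul_jordanBlock_apply {m : Type*} (c : ℂ) {p : ℕ} (A : Matrix m (Fin p) ℂ) (i : m)
    (j : Fin p) :
    (A * jordanBlock c p) i j =
      c * A i j + if h : 0 < (j : ℕ) then A i ⟨j - 1, by omega⟩ else 0 := by
  rw [Matrix.mul_apply]
  have h1 : ∀ k, A i k * jordanBlock c p k j =
      (if k = j then c * A i k else 0) + if (k : ℕ) + 1 = j then A i k else 0 := fun k => by
    simp only [jordanBlock, Matrix.of_apply]
    split_ifs with h h' h'
    · exact absurd h' (by rw [h]; omega)
    · ring
    all_goals simp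
  simp only [h1, Finset.sum_add_distrib]
  congr 1
  · simp
  · split_ifs with h
    · rw [Finset.sum_eq_single ⟨j - 1, by omega⟩]
      · rw [if_pos (by simp; omega)]
      · intro k _ hk
        rw [if_neg]
        exact fun e => hk (Fin.ext (by simp; omega))
      · simp
    · exact Finset.sum_eq_zero fun k _ => if_neg (by omega)

/-- A basis of Jordan chains yields a Jordan form; empty chains are dropped. -/
theorem exists_isJordanForm {N : ℕ} (F : Matrix (Fin N) (Fin N) ℝ) :
    ∃ B : JordanData, IsJordanForm F B := by
  classical
  obtain ⟨ι, hι, n, μ, v, hv⟩ := exists_jordan_basis (toComplex F).toLin'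
  let ε : Fin (Fintype.card {i // 0 < n i}) ≃ {i // 0 < n i} := (Fintype.equivFin _).symm
  let B : JordanData :=
    { numBlocks := Fintype.card {i // 0 < n i}
      size := fun i => n (ε i)
      size_pos := fun i => (ε i).2
      ev := fun i => μ (ε i) }
  let σ : (Σ i, Fin (B.size i)) ≃ Σ i, Fin (n i) :=
    { toFun := fun x => ⟨ε x.1, x.2⟩
      invFun := fun x => ⟨ε.symm ⟨x.1, x.2.pos⟩, Fin.cast (by simp [B]) x.2⟩
      left_inv := fun x => by
        rcases x with ⟨i, j⟩
        refine Sigma.ext (by simp) ?_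
        exact (Fin.heq_ext_iff (by simp)).2 rfl
      right_inv := fun x => by
        rcases x with ⟨i, j⟩
        refine Sigma.ext (by simp) ?_
        exact (Fin.heq_ext_iff (by simp)).2 rfl }
  let w := v.reindex σ.symm
  have hw : ∀ x, w x = v (σ x) := fun x => by simp [w]
  let C := (Pi.basisFun ℂ (Fin N)).toMatrix w
  let D := w.toMatrix (Pi.basisFun ℂ (Fin N))
  have hC : ∀ k x, C k x = w x k := fun k x => by simp [C, Module.Basis.toMatrix_apply]
  have hCD : C * D = 1 := Module.Basis.toMatrix_mul_toMatrix_flip _ _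
  have hDC : D * C = 1 := Module.Basis.toMatrix_mul_toMatrix_flip _ _
  refine ⟨B, C, D, hCD, hDC, ?_⟩
  have key : toComplex F * C = C * B.matrix := by
    ext k ⟨i, j⟩
    have h1 : (toComplex F * C) k ⟨i, j⟩ = (toComplex F).toLin' (w ⟨i, j⟩) k := by
      rw [Matrix.mul_apply, Matrix.toLin'_apply, Matrix.mulVec, dotProduct]
      exact Finset.sum_congr rfl fun l _ => by rw [hC]
    have h2 : (C * B.matrix) k ⟨i, j⟩ =
        ((Matrix.of fun k j => C k ⟨i, j⟩ : Matrix (Fin N) (Fin (B.size i)) ℂ) *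
          jordanBlock (B.ev i) (B.size i)) k j := by
      rw [Matrix.mul_apply, Fintype.sum_sigma, Finset.sum_eq_single i, Matrix.mul_apply]
      · refine Finset.sum_congr rfl fun l _ => ?_
        rw [JordanData.matrix, Matrix.blockDiagonal'_apply_eq]
        rfl
      · intro i' _ hi'
        refine Finset.sum_eq_zero fun l _ => ?_
        rw [JordanData.matrix, Matrix.blockDiagonal'_apply_ne _ _ _ hi', mul_zero]
      · simp
    have h3 := congrFun (hv (ε i) j) k
    rw [h1, h2, mul_jordanBlock_apply, hw]
    simp only [Matrix.of_apply, hC, hw]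
    refine h3.trans ?_
    rw [Pi.add_apply, Pi.smul_apply, smul_eq_mul]
    congr 1
    split_ifs
    · rfl
    · rfl
  rw [← key, Matrix.mul_assoc, hCD, Matrix.mul_one]

end

/-! ### Uniqueness of the Jordan form -/

theorem jordanBlock_sub_smul_one (c μ : ℂ) (n : ℕ) :
    jordanBlock c n - μ • 1 = jordanBlock (c - μ) n := by
  ext i j
  simp only [jordanBlock, Matrix.sub_apply, Matrix.smul_apply, Matrix.of_apply, Matrix.one_apply,
    smul_eq_mul]
  split_ifs <;> simp

theorem det_jordanBlock (c : ℂ) (n : ℕ) : (jordanBlock c n).det = c ^ n := by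
  rw [Matrix.det_of_isUpperTriangular]
  · simp [jordanBlock]
  · intro i j hij
    have hij : (j : ℕ) < i := hij
    simp only [jordanBlock, Matrix.of_apply]
    rw [if_neg (fun h => by rw [h] at hij; omega), if_neg (by omega)]

theorem jordanBlock_zero_pow (n k : ℕ) :
    jordanBlock 0 n ^ k = Matrix.of fun i j : Fin n => if (i : ℕ) + k = j then 1 else 0 := by
  induction k with
  | zero =>
    ext i j
    simp [Matrix.one_apply, Fin.ext_iff]
  | succ k ih =>
    rw [pow_succ, ih]
    ext i j
    rw [mul_jordanBlock_apply]
    simp only [Matrix.of_apply, zero_mul, zero_add]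
    split_ifs <;> first | rfl | omega

/-- A power of a shifted Jordan block is an invertible matrix times a diagonal projection, which
reads off its rank: a nilpotent block is a cyclic shift composed with a projection. -/
theorem exists_isUnit_mul_diagonal (c μ : ℂ) (n k : ℕ) :
    ∃ U : Matrix (Fin n) (Fin n) ℂ, IsUnit U ∧ (jordanBlock c n - μ • 1) ^ k =
      U * Matrix.diagonal fun j : Fin n => if c = μ ∧ (j : ℕ) < k then 0 else 1 := by
  rw [jordanBlock_sub_smul_one]
  by_cases h : c = μ
  · subst h
    rcases Nat.eq_zero_or_pos n with rfl | hn
    · exact ⟨1, isUnit_one, Subsingleton.elim _ _⟩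
    have : NeZero n := ⟨hn.ne'⟩
    let σ : Equiv.Perm (Fin n) := Equiv.addRight (Fin.ofNat n k)
    have hσ : ∀ i : Fin n, ((σ i : Fin n) : ℕ) = (i + k) % n := fun i => by
      simp [σ, Fin.val_add]
    refine ⟨(1 : Matrix (Fin n) (Fin n) ℂ).submatrix σ id, ?_, ?_⟩
    · rw [Matrix.isUnit_iff_isUnit_det, Matrix.det_permute, Matrix.det_one, mul_one]
      exact (Equiv.Perm.sign σ).isUnit.map (Int.castRingHom ℂ)
    · rw [sub_self, jordanBlock_zero_pow]
      ext i j
      simp only [Matrix.mul_diagonal, Matrix.of_apply, Matrix.submatrix_apply, Matrix.one_apply, id,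
        Fin.ext_iff, hσ, true_and]
      have hj := j.2
      have hi := i.2
      by_cases hjk : (j : ℕ) < k
      · rw [if_neg (by omega), if_pos hjk, mul_zero]
      · rw [if_neg hjk, mul_one]
        congr 1
        apply propext
        constructor
        · intro h
          rw [h, Nat.mod_eq_of_lt hj]
        · intro h
          have h2 := Nat.div_add_mod ((i : ℕ) + k) n
          have h3 : ((i : ℕ) + k) / n < 2 := Nat.div_lt_of_lt_mul (by omega)
          interval_cases hd : ((i : ℕ) + k) / n <;> omega
  · refine ⟨jordanBlock (c - μ) n ^ k, ?_, ?_⟩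
    · refine IsUnit.pow k ?_
      rw [Matrix.isUnit_iff_isUnit_det, det_jordanBlock, isUnit_iff_ne_zero]
      exact pow_ne_zero _ (sub_ne_zero.2 h)
    · simp [h]

theorem isUnit_blockDiagonal' {ι : Type*} [Fintype ι] [DecidableEq ι] {n : ι → Type*}
    [∀ i, Fintype (n i)] [∀ i, DecidableEq (n i)] {U : ∀ i, Matrix (n i) (n i) ℂ}
    (hU : ∀ i, IsUnit (U i)) : IsUnit (Matrix.blockDiagonal' U) :=
  (Pi.isUnit_iff.2 hU).map (Matrix.blockDiagonal'RingHom n ℂ)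

/-- The nullity of `(J - μ) ^ k` is the sum of `min n k` over the sizes `n` of the blocks with
eigenvalue `μ`. -/
theorem JordanData.rank_add (B : JordanData) (μ : ℂ) (k : ℕ) :
    ((B.matrix - μ • 1) ^ k).rank + ∑ i, (if B.ev i = μ then min (B.size i) k else 0) =
      ∑ i, B.size i := by
  classical
  choose U hU hUd using fun i => exists_isUnit_mul_diagonal (B.ev i) μ (B.size i) k
  have h1 : (B.matrix - μ • 1) ^ k = Matrix.blockDiagonal' U * Matrix.diagonal
      fun x : Σ i, Fin (B.size i) => if B.ev x.1 = μ ∧ (x.2 : ℕ) < k then 0 else 1 := by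
    rw [JordanData.matrix, ← Matrix.blockDiagonal'_one, ← Matrix.blockDiagonal'_smul,
      ← Matrix.blockDiagonal'_sub, ← Matrix.blockDiagonal'_pow]
    rw [← Matrix.blockDiagonal'_diagonal (fun i (j : Fin (B.size i)) =>
      if B.ev i = μ ∧ (j : ℕ) < k then (0 : ℂ) else 1), ← Matrix.blockDiagonal'_mul]
    congr 1
    funext i
    exact hUd i
  rw [h1, Matrix.rank_mul_eq_right_of_isUnit_det _ _
    ((Matrix.isUnit_iff_isUnit_det _).1 (isUnit_blockDiagonal' hU)), Matrix.rank_diagonal,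
    Fintype.card_subtype, Finset.card_filter, Fintype.sum_sigma, ← Finset.sum_add_distrib]
  refine Finset.sum_congr rfl fun i _ => ?_
  by_cases h : B.ev i = μ
  · simp only [h, true_and, ne_eq, ite_eq_left_iff, one_ne_zero, imp_false, not_not, if_true]
    rw [← Finset.card_filter]
    have h2 := Finset.card_filter_add_card_filter_not (s := (Finset.univ : Finset (Fin (B.size i))))
      (fun j => (j : ℕ) < k)
    have h3 : (Finset.univ.filter fun j : Fin (B.size i) => (j : ℕ) < k).card =
        min (B.size i) k := by
      rw [Fin.card_filter_val_lt]
    rw [Finset.card_univ, Fintype.card_fin, h3] at h2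
    omega
  · simp [h]

/-- Similar Jordan matrices have the same blocks, up to their order: the number of blocks of
size `k + 1` with eigenvalue `μ` is a second difference of the ranks of the powers of `J - μ`. -/
theorem JordanData.exists_equiv_of_similar (B B' : JordanData)
    (P : Matrix (Σ i, Fin (B.size i)) (Σ i, Fin (B'.size i)) ℂ)
    (Q : Matrix (Σ i, Fin (B'.size i)) (Σ i, Fin (B.size i)) ℂ)
    (hPQ : P * Q = 1) (hQP : Q * P = 1) (h : B.matrix * P = P * B'.matrix) :
    ∃ e : Fin B.numBlocks ≃ Fin B'.numBlocks, ∀ i,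
      B'.size (e i) = B.size i ∧ B'.ev (e i) = B.ev i := by
  classical
  have hpow : ∀ (μ : ℂ) (k : ℕ), (B.matrix - μ • 1) ^ k * P = P * (B'.matrix - μ • 1) ^ k := fun μ k => by
    induction k with
    | zero => simp
    | succ k ih =>
      have h1 : (B.matrix - μ • 1) * P = P * (B'.matrix - μ • 1) := by
        rw [Matrix.sub_mul, h, Matrix.smul_mul, Matrix.one_mul, Matrix.mul_sub, Matrix.mul_smul,
          Matrix.mul_one]
      rw [pow_succ, Matrix.mul_assoc, h1, ← Matrix.mul_assoc, ih, Matrix.mul_assoc, ← pow_succ]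
  have hrank : ∀ (μ : ℂ) (k : ℕ), ((B.matrix - μ • 1) ^ k).rank = ((B'.matrix - μ • 1) ^ k).rank := fun μ k => by
    apply le_antisymm
    · have h1 : (B.matrix - μ • 1) ^ k = P * (B'.matrix - μ • 1) ^ k * Q := by
        rw [← hpow, Matrix.mul_assoc, hPQ, Matrix.mul_one]
      rw [h1]
      exact (Matrix.rank_mul_le_left _ _).trans (Matrix.rank_mul_le_right _ _)
    · have h1 : (B'.matrix - μ • 1) ^ k = Q * ((B.matrix - μ • 1) ^ k * P) := by
        rw [hpow, ← Matrix.mul_assoc, hQP, Matrix.one_mul]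
      rw [h1]
      exact (Matrix.rank_mul_le_right _ _).trans (Matrix.rank_mul_le_left _ _)
  have htot : ∑ i, B.size i = ∑ i, B'.size i := by
    have h1 := hrank 0 0
    rw [pow_zero, pow_zero, Matrix.rank_one, Matrix.rank_one] at h1
    simpa [Fintype.card_sigma] using h1
  have hmin : ∀ (μ : ℂ) (k : ℕ), ∑ i, (if B.ev i = μ then min (B.size i) k else 0) =
      ∑ i, (if B'.ev i = μ then min (B'.size i) k else 0) := fun μ k => by
    have h1 := B.rank_add μ k
    have h2 := B'.rank_add μ k
    rw [hrank, htot] at h1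
    omega
  -- `2 min(n, k+1) - min(n, k) - min(n, k+2)` is `1` if `n = k + 1` and `0` otherwise
  have hcount : ∀ (A : JordanData) (μ : ℂ) (k : ℕ),
      Fintype.card {i // (A.ev i, A.size i) = (μ, k + 1)} +
        ((∑ i, if A.ev i = μ then min (A.size i) k else 0) +
          ∑ i, if A.ev i = μ then min (A.size i) (k + 2) else 0) =
        2 * ∑ i, if A.ev i = μ then min (A.size i) (k + 1) else 0 := fun A μ k => by
    rw [Fintype.card_subtype, Finset.card_filter, Finset.mul_sum, ← Finset.sum_add_distrib,
      ← Finset.sum_add_distrib]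
    refine Finset.sum_congr rfl fun i _ => ?_
    simp only [Prod.mk.injEq]
    by_cases h : A.ev i = μ
    · simp only [h, true_and, if_true]
      split_ifs <;> omega
    · simp [h]
  have hfiber : ∀ c : ℂ × ℕ, Nonempty ({i // (B.ev i, B.size i) = c} ≃
      {i // (B'.ev i, B'.size i) = c}) := by
    rintro ⟨μ, k⟩
    refine ⟨Fintype.equivOfCardEq ?_⟩
    rcases k with _ | k
    · -- there are no blocks of size `0`
      have hz : ∀ A : JordanData, Fintype.card {i // (A.ev i, A.size i) = (μ, 0)} = 0 := fun A => by
        rw [Fintype.card_eq_zero_iff]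
        exact ⟨fun i => (A.size_pos i).ne' (congrArg Prod.snd i.2)⟩
      rw [hz, hz]
    · have h1 := hcount B μ k
      have h2 := hcount B' μ k
      rw [hmin, hmin, hmin] at h1
      omega
  have ε := fun c => (hfiber c).some
  refine ⟨Equiv.ofFiberEquiv ε, fun i => ?_⟩
  have h1 := Equiv.ofFiberEquiv_map ε i
  exact ⟨congrArg Prod.snd h1, congrArg Prod.fst h1⟩

/-! ### Mixtures that match a Jordan form -/

section
open scoped Matrix.Norms.Operator

/-- The exponential commutes with a change of coordinates between different index types. -/
theorem exp_conj_of_mul_eq_one {m n : Type*} [Fintype m] [DecidableEq m] [Fintype n]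
    [DecidableEq n] {C : Matrix m n ℂ} {D : Matrix n m ℂ} (hCD : C * D = 1) (hDC : D * C = 1)
    (A : Matrix n n ℂ) : NormedSpace.exp (C * A * D) = C * NormedSpace.exp A * D := by
  let φ : Matrix n n ℂ →+* Matrix m m ℂ :=
    { toFun := fun A => C * A * D
      map_one' := by rw [Matrix.mul_one, hCD]
      map_mul' := fun A B => by
        simp only [Matrix.mul_assoc]
        rw [← Matrix.mul_assoc D C, hDC, Matrix.one_mul]
      map_zero' := by simp
      map_add' := fun A B => by rw [Matrix.mul_add, Matrix.add_mul] }
  have hφ : Continuous φ := by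
    exact (continuous_const.matrix_mul continuous_id).matrix_mul continuous_const
  exact (NormedSpace.map_exp φ hφ A).symm

/-- A one-parameter semigroup determines its generator, its right derivative at `0`. -/
theorem eq_of_exp_smul_eq {n : Type*} [Fintype n] [DecidableEq n] {A B : Matrix n n ℂ}
    (h : ∀ τ : ℝ, 0 ≤ τ → NormedSpace.exp ((τ : ℂ) • A) = NormedSpace.exp ((τ : ℂ) • B)) :
    A = B := by
  have hd : ∀ A : Matrix n n ℂ,
      HasDerivAt (fun τ : ℝ => NormedSpace.exp ((τ : ℂ) • A)) A 0 := fun A => by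
    have h1 := hasDerivAt_exp_smul_const (𝕂 := ℝ) A 0
    rw [zero_smul, NormedSpace.exp_zero, one_mul] at h1
    have h2 : ∀ τ : ℝ, (τ : ℂ) • A = τ • A := fun τ => by ext i j; simp
    simp only [h2]
    exact h1
  have hA := (hd A).hasDerivWithinAt (s := Set.Ici 0)
  have hB := (hd B).hasDerivWithinAt (s := Set.Ici 0)
  exact (uniqueDiffOn_Ici 0 0 Set.self_mem_Ici).eq_deriv _ hA
    (hB.congr (fun τ hτ => h τ hτ) (h 0 le_rfl))

end

/-- The Jordan matrix that a mixture matches, indexed by the state of the mixture. -/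
def Mixture.jordanMatrix (K : Mixture) : Matrix K.State K.State ℂ :=
  Matrix.blockDiagonal' fun i => jordanBlock ⟨-K.decay i, K.freq i⟩ (K.order i)

/-- The Jordan blocks that a mixture matches. -/
def Mixture.jordanData (K : Mixture) : JordanData where
  numBlocks := K.numMixands
  size := K.order
  size_pos := K.order_pos
  ev := fun i => ⟨-K.decay i, K.freq i⟩

open scoped Matrix.Norms.Operator in
/-- The factorization of `stateCov_eq` for a mixture; the weights are absorbed into `R`. -/
theorem Mixture.exists_cov_eq (K : Mixture) :
    ∃ O R : Matrix K.State K.State ℂ, IsUnit O.det ∧ IsUnit R.det ∧ ∀ τ : ℝ, 0 ≤ τ →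
      K.cov τ = O * NormedSpace.exp ((τ : ℂ) • K.jordanMatrix) *
        R := by
  choose O R hO hR h using fun i => stateCov_eq (K.order_pos i) (K.decay_pos i) (K.freq i)
  refine ⟨Matrix.blockDiagonal' O, Matrix.blockDiagonal' fun i => ((K.weight i : ℝ) : ℂ) • R i,
    ?_, ?_, fun τ hτ => ?_⟩
  · exact (Matrix.isUnit_iff_isUnit_det _).1 (isUnit_blockDiagonal' fun i =>
      (Matrix.isUnit_iff_isUnit_det _).2 (hO i))
  · refine (Matrix.isUnit_iff_isUnit_det _).1 (isUnit_blockDiagonal' fun i =>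
      (Matrix.isUnit_iff_isUnit_det _).2 ?_)
    rw [Matrix.det_smul]
    refine IsUnit.mul (IsUnit.pow _ ?_) (hR i)
    rw [isUnit_iff_ne_zero]
    exact_mod_cast (K.weight_pos i).ne'
  · have h1 : NormedSpace.exp ((τ : ℂ) • K.jordanMatrix) =
        Matrix.blockDiagonal' fun i => NormedSpace.exp
          ((τ : ℂ) • jordanBlock (⟨-K.decay i, K.freq i⟩ : ℂ) (K.order i)) := by
      rw [Mixture.jordanMatrix, ← Matrix.blockDiagonal'_smul]
      refine (Matrix.exp_blockDiagonal' _).trans ?_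
      congr 1
      funext i
      exact Pi.coe_exp (fun i => (τ : ℂ) • jordanBlock ⟨-K.decay i, K.freq i⟩ (K.order i)) i
    rw [h1, ← Matrix.blockDiagonal'_mul, ← Matrix.blockDiagonal'_mul, Mixture.cov]
    congr 1
    funext i
    rw [h i τ hτ, Matrix.mul_smul]

theorem Mixture.isUnit_det_cov (K : Mixture) {τ : ℝ} (hτ : 0 ≤ τ) : IsUnit (K.cov τ).det := by
  obtain ⟨O, R, hO, hR, h⟩ := K.exists_cov_eq
  rw [h τ hτ, Matrix.det_mul, Matrix.det_mul]
  exact (hO.mul ((Matrix.isUnit_iff_isUnit_det _).1 (Matrix.isUnit_exp _))).mul hR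

/-- The transition matrices of a mixture are, in suitable coordinates, the exponentials of the
Jordan matrix that the mixture matches. -/
theorem Mixture.exists_transition_eq (K : Mixture) :
    ∃ O : Matrix K.State K.State ℂ, IsUnit O.det ∧ ∀ τ : ℝ, 0 ≤ τ →
      K.transition τ =
        O * NormedSpace.exp ((τ : ℂ) • K.jordanMatrix) *
          O⁻¹ := by
  obtain ⟨O, R, hO, hR, h⟩ := K.exists_cov_eq
  refine ⟨O, hO, fun τ hτ => ?_⟩
  have h0 := h 0 le_rfl
  rw [Complex.ofReal_zero, zero_smul, NormedSpace.exp_zero, Matrix.mul_one] at h0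
  rw [Mixture.transition, h0, h τ hτ, Matrix.mul_inv_rev, Matrix.mul_assoc, ← Matrix.mul_assoc R,
    Matrix.mul_nonsing_inv _ hR, Matrix.one_mul]

/-- Reindexing along the bijection of mixands and blocks turns one Jordan matrix into the other. -/
theorem Mixture.Matches.exists_submatrix_eq {K : Mixture} {B : JordanData} (h : K.Matches B) :
    ∃ σ : K.State ≃ Σ i, Fin (B.size i),
      B.matrix.submatrix σ σ = K.jordanMatrix := by
  obtain ⟨e, he⟩ := h
  refine ⟨Equiv.sigmaCongr e fun i => finCongr (he i).1.symm, ?_⟩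
  ext ⟨i, j⟩ ⟨i', j'⟩
  rw [Matrix.submatrix_apply]
  by_cases hi : i = i'
  · subst hi
    have h1 : K.jordanMatrix ⟨i, j⟩ ⟨i, j'⟩ =
        jordanBlock ⟨-K.decay i, K.freq i⟩ (K.order i) j j' :=
      Matrix.blockDiagonal'_apply_eq
        (fun i => jordanBlock ⟨-K.decay i, K.freq i⟩ (K.order i)) i j j'
    have h2 : B.matrix ⟨e i, finCongr (he i).1.symm j⟩ ⟨e i, finCongr (he i).1.symm j'⟩ =
        jordanBlock (B.ev (e i)) (B.size (e i)) (finCongr (he i).1.symm j)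
          (finCongr (he i).1.symm j') :=
      Matrix.blockDiagonal'_apply_eq _ _ _ _
    refine h2.trans (Eq.trans ?_ h1.symm)
    simp only [jordanBlock, Matrix.of_apply, Fin.ext_iff, (he i).2, finCongr_apply, Fin.val_cast]
  · have h1 : K.jordanMatrix ⟨i, j⟩ ⟨i', j'⟩ = 0 :=
      Matrix.blockDiagonal'_apply_ne _ _ _ hi
    exact (Matrix.blockDiagonal'_apply_ne _ _ _ (e.injective.ne hi)).trans h1.symm

theorem Mixture.Matches.exists_isCoordinateChange {N : ℕ} {F : Matrix (Fin N) (Fin N) ℝ}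
    {K : Mixture} {B : JordanData} (h : K.Matches B) (hB : IsJordanForm F B) :
    ∃ (X : Matrix (Fin N) K.State ℂ) (Y : Matrix K.State (Fin N) ℂ),
      K.IsCoordinateChange F X Y := by
  obtain ⟨σ, hσ⟩ := h.exists_submatrix_eq
  obtain ⟨C, D, hCD, hDC, hF⟩ := hB
  obtain ⟨O, hO, hT⟩ := K.exists_transition_eq
  have hCD' : C.submatrix id σ * D.submatrix σ id = 1 := by
    rw [Matrix.submatrix_mul_equiv, hCD, Matrix.submatrix_id_id]
  have hDC' : D.submatrix σ id * C.submatrix id σ = 1 := by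
    have := Matrix.submatrix_mul_equiv D C σ (Equiv.refl _) σ
    rw [Equiv.coe_refl] at this
    rw [this, hDC, Matrix.submatrix_one_equiv]
  have hF' : toComplex F = C.submatrix id σ * K.jordanMatrix *
      D.submatrix σ id := by
    rw [← hσ, Matrix.submatrix_mul_equiv, Matrix.submatrix_mul_equiv, hF, Matrix.submatrix_id_id]
  have hO1 : O⁻¹ * O = 1 := Matrix.nonsing_inv_mul _ hO
  have hO2 : O * O⁻¹ = 1 := Matrix.mul_nonsing_inv _ hO
  refine ⟨C.submatrix id σ * O⁻¹, O * D.submatrix σ id, ?_, ?_, fun τ hτ => ?_⟩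
  · rw [Matrix.mul_assoc, ← Matrix.mul_assoc O⁻¹, hO1, Matrix.one_mul, hCD']
  · rw [Matrix.mul_assoc, ← Matrix.mul_assoc (D.submatrix σ id), hDC', Matrix.one_mul, hO2]
  · rw [hT τ hτ, hF', ← Matrix.smul_mul, ← Matrix.mul_smul, exp_conj_of_mul_eq_one hCD' hDC']
    simp only [Matrix.mul_assoc]
    rw [← Matrix.mul_assoc O⁻¹ O, hO1, Matrix.one_mul, ← Matrix.mul_assoc O⁻¹ O, hO1,
      Matrix.one_mul]

theorem Mixture.IsCoordinateChange.matches {N : ℕ} {F : Matrix (Fin N) (Fin N) ℝ}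
    {K : Mixture} {B : JordanData} {X : Matrix (Fin N) K.State ℂ} {Y : Matrix K.State (Fin N) ℂ}
    (h : K.IsCoordinateChange F X Y) (hB : IsJordanForm F B) : K.Matches B := by
  obtain ⟨hXY, hYX, hexp⟩ := h
  obtain ⟨C, D, hCD, hDC, hF⟩ := hB
  obtain ⟨O, hO, hT⟩ := K.exists_transition_eq
  have hO1 : O⁻¹ * O = 1 := Matrix.nonsing_inv_mul _ hO
  have hO2 : O * O⁻¹ = 1 := Matrix.mul_nonsing_inv _ hO
  set J : Matrix K.State K.State ℂ := K.jordanMatrix with hJ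
  have h1 : (X * O) * (O⁻¹ * Y) = 1 := by
    rw [Matrix.mul_assoc, ← Matrix.mul_assoc O, hO2, Matrix.one_mul, hXY]
  have h2 : (O⁻¹ * Y) * (X * O) = 1 := by
    rw [Matrix.mul_assoc, ← Matrix.mul_assoc Y, hYX, Matrix.one_mul, hO1]
  have hgen : toComplex F = X * O * J * (O⁻¹ * Y) := by
    refine eq_of_exp_smul_eq fun τ hτ => ?_
    rw [hexp τ hτ, hT τ hτ, ← Matrix.smul_mul, ← Matrix.mul_smul, exp_conj_of_mul_eq_one h1 h2]
    simp only [Matrix.mul_assoc]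
  have hP : (O⁻¹ * Y * C) * (D * (X * O)) = 1 := by
    rw [Matrix.mul_assoc, ← Matrix.mul_assoc C, hCD, Matrix.one_mul, h2]
  have hQ : (D * (X * O)) * (O⁻¹ * Y * C) = 1 := by
    rw [Matrix.mul_assoc, ← Matrix.mul_assoc (X * O), h1, Matrix.one_mul, hDC]
  have hsim : J * (O⁻¹ * Y * C) = (O⁻¹ * Y * C) * B.matrix := by
    have e1 : (O⁻¹ * Y) * toComplex F = J * (O⁻¹ * Y) := by
      rw [hgen, Matrix.mul_assoc (X * O), ← Matrix.mul_assoc (O⁻¹ * Y), h2, Matrix.one_mul]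
    have e2 : toComplex F * C = C * B.matrix := by
      rw [hF, Matrix.mul_assoc, hDC, Matrix.mul_one]
    rw [← Matrix.mul_assoc, ← e1, Matrix.mul_assoc, e2, ← Matrix.mul_assoc]
  exact K.jordanData.exists_equiv_of_similar B (O⁻¹ * Y * C) (D * (X * O)) hP hQ hsim

/-- The first vector of a Jordan chain is an eigenvector. -/
theorem IsJordanForm.ev_mem_spectrum {N : ℕ} {F : Matrix (Fin N) (Fin N) ℝ} {B : JordanData}
    (hB : IsJordanForm F B) (i : Fin B.numBlocks) : B.ev i ∈ spectrum ℂ (toComplex F) := by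
  obtain ⟨C, D, hCD, hDC, hF⟩ := hB
  rw [spectrum.mem_iff]
  intro hu
  let e : (Σ i, Fin (B.size i)) → ℂ := Pi.single ⟨i, ⟨0, B.size_pos i⟩⟩ 1
  have hJ : B.matrix *ᵥ e = B.ev i • e := by
    ext ⟨i', j⟩
    rw [Matrix.mulVec_single_one, Pi.smul_apply, smul_eq_mul]
    by_cases hi : i' = i
    · subst hi
      have h1 : B.matrix ⟨i', j⟩ ⟨i', ⟨0, B.size_pos i'⟩⟩ =
          jordanBlock (B.ev i') (B.size i') j ⟨0, B.size_pos i'⟩ :=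
        Matrix.blockDiagonal'_apply_eq _ _ _ _
      refine h1.trans ?_
      by_cases hj : j = ⟨0, B.size_pos i'⟩
      · subst hj; simp [jordanBlock, e]
      · have : (⟨i', j⟩ : Σ i, Fin (B.size i)) ≠ ⟨i', ⟨0, B.size_pos i'⟩⟩ := fun h =>
          hj (eq_of_heq (Sigma.mk.inj h).2)
        simp [jordanBlock, e, hj, this]
    · have h1 : B.matrix ⟨i', j⟩ ⟨i, ⟨0, B.size_pos i⟩⟩ = 0 :=
        Matrix.blockDiagonal'_apply_ne _ _ _ hi
      have : (⟨i', j⟩ : Σ i, Fin (B.size i)) ≠ ⟨i, ⟨0, B.size_pos i⟩⟩ := fun h =>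
        hi (Sigma.mk.inj h).1
      refine h1.trans ?_
      simp [e, this]
  have hv : (algebraMap ℂ (Matrix (Fin N) (Fin N) ℂ) (B.ev i) - toComplex F) *ᵥ (C *ᵥ e) = 0 := by
    have hFC : toComplex F * C = C * B.matrix := by
      rw [hF, Matrix.mul_assoc, hDC, Matrix.mul_one]
    rw [Matrix.sub_mulVec, Matrix.mulVec_mulVec (M := toComplex F), hFC, ← Matrix.mulVec_mulVec, hJ,
      Algebra.algebraMap_eq_smul_one, Matrix.smul_mulVec, Matrix.one_mulVec, Matrix.mulVec_smul,
      sub_self]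
  have hCe : C *ᵥ e = 0 := by
    obtain ⟨u, hu⟩ := hu
    rw [← hu] at hv
    have := congrArg (fun w => (↑u⁻¹ : Matrix (Fin N) (Fin N) ℂ) *ᵥ w) hv
    simpa [Matrix.mulVec_mulVec] using this
  have he : e = 0 := by
    have := congrArg (fun w => D *ᵥ w) hCe
    simpa [Matrix.mulVec_mulVec, hDC] using this
  have := congrFun he ⟨i, ⟨0, B.size_pos i⟩⟩
  simp [e] at this

theorem IsJordanForm.exists_matches {N : ℕ} {F : Matrix (Fin N) (Fin N) ℝ} {B : JordanData}
    (hB : IsJordanForm F B) (hF : IsStable F) : ∃ K : Mixture, K.Matches B :=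
  ⟨{ numMixands := B.numBlocks
     order := B.size
     order_pos := B.size_pos
     decay := fun i => -(B.ev i).re
     decay_pos := fun i => neg_pos.2 (hF _ (hB.ev_mem_spectrum i))
     freq := fun i => (B.ev i).im
     weight := fun _ => 1
     weight_pos := fun _ => one_pos }, Equiv.refl _, fun i => ⟨rfl, by simp⟩⟩

theorem Mixture.Matches.sum_order {N : ℕ} {F : Matrix (Fin N) (Fin N) ℝ} {K : Mixture}
    {B : JordanData} (h : K.Matches B) (hB : IsJordanForm F B) : ∑ i, K.order i = N := by
  obtain ⟨e, he⟩ := h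
  obtain ⟨C, D, hCD, hDC, -⟩ := hB
  have h1 : Fintype.card (Fin N) = Fintype.card (Σ i, Fin (B.size i)) := by
    have hC := Matrix.rank_one (R := ℂ) (n := Fin N)
    have hD := Matrix.rank_one (R := ℂ) (n := Σ i, Fin (B.size i))
    rw [← hCD] at hC
    rw [← hDC] at hD
    exact le_antisymm (hC ▸ (Matrix.rank_mul_le_left C D).trans (Matrix.rank_le_card_width C))
      (hD ▸ (Matrix.rank_mul_le_left D C).trans (Matrix.rank_le_card_width D))
  rw [Fintype.card_fin, Fintype.card_sigma] at h1
  simp only [Fintype.card_fin] at h1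
  rw [h1, ← Equiv.sum_comp e]
  exact Finset.sum_congr rfl fun i _ => (he i).1.symm

/-! ### Variation of constants and Riemann sums -/

section

open Filter Topology

/-- The `k`-th point of the partition of `[s, t]` into `n` intervals of equal length; `k` may be
fractional, which gives the points between them. -/
def gridPoint (s t : ℝ) (n : ℕ) (k : ℝ) : ℝ := s + k * ((t - s) / n)

theorem gridPoint_zero (s t : ℝ) (n : ℕ) : gridPoint s t n 0 = s := by simp [gridPoint]

theorem gridPoint_self (s t : ℝ) {n : ℕ} (hn : n ≠ 0) : gridPoint s t n n = t := by
  have : (n : ℝ) ≠ 0 := by exact_mod_cast hn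
  rw [gridPoint]
  field_simp
  ring

theorem gridPoint_mono {s t : ℝ} (hst : s ≤ t) (n : ℕ) : Monotone (gridPoint s t n) :=
  fun _ _ hkl => by
    have : 0 ≤ (t - s) / n := div_nonneg (sub_nonneg.2 hst) n.cast_nonneg
    exact add_le_add_right (mul_le_mul_of_nonneg_right hkl this) s

theorem gridPoint_mem_Icc {s t : ℝ} (hst : s ≤ t) {n : ℕ} (hn : n ≠ 0) {k : ℝ} (h0 : 0 ≤ k)
    (hk : k ≤ n) : gridPoint s t n k ∈ Set.Icc s t := by
  have h1 := gridPoint_mono hst n h0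
  have h2 := gridPoint_mono hst n hk
  rw [gridPoint_zero] at h1
  rw [gridPoint_self s t hn] at h2
  exact ⟨h1, h2⟩

/-- Convergence of Riemann sums in which only one of two occurrences of the integration variable
is discretized; `c ∈ [0, 1]` places the tag within each interval of the partition. -/
theorem tendsto_sum_integral_gridPoint {E : Type*} [NormedAddCommGroup E] [NormedSpace ℝ E]
    {Ψ : ℝ → ℝ → E} (hΨ : Continuous (Function.uncurry Ψ)) {s t : ℝ} (hst : s ≤ t) {c : ℝ}
    (hc0 : 0 ≤ c) (hc1 : c ≤ 1) :
    Tendsto (fun n : ℕ => ∑ k ∈ Finset.range n,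
      ∫ u in gridPoint s t n k..gridPoint s t n (k + 1 : ℕ), Ψ (gridPoint s t n (k + c)) u)
      atTop (𝓝 (∫ u in s..t, Ψ u u)) := by
  rw [Metric.tendsto_atTop]
  intro ε hε
  have hT : 0 ≤ t - s := sub_nonneg.2 hst
  have huc : UniformContinuousOn (Function.uncurry Ψ) (Set.Icc s t ×ˢ Set.Icc s t) :=
    (isCompact_Icc.prod isCompact_Icc).uniformContinuousOn_of_continuous hΨ.continuousOn
  rw [Metric.uniformContinuousOn_iff] at huc
  obtain ⟨δ, hδ, huc⟩ := huc (ε / (t - s + 1)) (by positivity)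
  obtain ⟨n₀, hn₀⟩ := exists_nat_gt ((t - s) / δ)
  refine ⟨n₀ + 1, fun n hn => ?_⟩
  have hn0 : n ≠ 0 := by omega
  have hnpos : (0 : ℝ) < n := by exact_mod_cast Nat.pos_of_ne_zero hn0
  have hmesh : (t - s) / n < δ := by
    rw [div_lt_iff₀ hnpos]
    rw [div_lt_iff₀ hδ] at hn₀
    have : (n₀ : ℝ) ≤ n := by exact_mod_cast (by omega : n₀ ≤ n)
    nlinarith
  have hint : ∀ (x : ℝ) (a b : ℝ), IntervalIntegrable (fun u => Ψ x u) volume a b := fun x a b =>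
    (hΨ.comp (by fun_prop : Continuous fun u : ℝ => (x, u))).intervalIntegrable a b
  have hint' : ∀ a b : ℝ, IntervalIntegrable (fun u => Ψ u u) volume a b := fun a b =>
    (hΨ.comp (by fun_prop : Continuous fun u : ℝ => (u, u))).intervalIntegrable a b
  have hsum : ∑ k ∈ Finset.range n, ∫ u in gridPoint s t n k..gridPoint s t n (k + 1 : ℕ), Ψ u u =
      ∫ u in s..t, Ψ u u := by
    have := intervalIntegral.sum_integral_adjacent_intervals (μ := volume) (f := fun u => Ψ u u)
      (a := fun k : ℕ => gridPoint s t n k) (n := n) fun k _ => hint' _ _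
    rw [this, Nat.cast_zero, gridPoint_zero, gridPoint_self s t hn0]
  rw [← hsum, dist_eq_norm, ← Finset.sum_sub_distrib]
  have hstep : ∀ k ∈ Finset.range n,
      ‖(∫ u in gridPoint s t n k..gridPoint s t n (k + 1 : ℕ), Ψ (gridPoint s t n (k + c)) u) -
        ∫ u in gridPoint s t n k..gridPoint s t n (k + 1 : ℕ), Ψ u u‖ ≤
      ε / (t - s + 1) * ((t - s) / n) := fun k hk => by
    have hk : k < n := Finset.mem_range.1 hk
    have hk1 : ((k + 1 : ℕ) : ℝ) ≤ n := by exact_mod_cast hk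
    have hle : gridPoint s t n k ≤ gridPoint s t n (k + 1 : ℕ) :=
      gridPoint_mono hst n (by push_cast; linarith)
    have hlen : gridPoint s t n (k + 1 : ℕ) - gridPoint s t n k = (t - s) / n := by
      simp only [gridPoint]; push_cast; ring
    rw [← intervalIntegral.integral_sub (hint _ _ _) (hint' _ _)]
    refine (intervalIntegral.norm_integral_le_of_norm_le_const (C := ε / (t - s + 1))
      fun u hu => ?_).trans (le_of_eq ?_)
    · rw [Set.uIoc_of_le hle] at hu
      have hk0 : (0 : ℝ) ≤ k := k.cast_nonneg
      have hx1 : gridPoint s t n k ≤ gridPoint s t n (k + c) :=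
        gridPoint_mono hst n (by linarith)
      have hx2 : gridPoint s t n (k + c) ≤ gridPoint s t n (k + 1 : ℕ) :=
        gridPoint_mono hst n (by push_cast; linarith)
      have ha := gridPoint_mem_Icc hst hn0 hk0 (by push_cast at hk1; linarith)
      have hb := gridPoint_mem_Icc hst hn0 (k + 1 : ℕ).cast_nonneg hk1
      have hxm : gridPoint s t n (k + c) ∈ Set.Icc s t := ⟨ha.1.trans hx1, hx2.trans hb.2⟩
      have hum : u ∈ Set.Icc s t := ⟨ha.1.trans hu.1.le, hu.2.trans hb.2⟩
      have hd : dist (gridPoint s t n (k + c)) u < δ := by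
        rw [Real.dist_eq, abs_lt]
        constructor <;> linarith [hu.1, hu.2]
      have := huc (gridPoint s t n (k + c), u) ⟨hxm, hum⟩ (u, u) ⟨hum, hum⟩ (by
        rw [Prod.dist_eq, dist_self, max_eq_left dist_nonneg]; exact hd)
      rw [dist_eq_norm] at this
      exact this.le
    · rw [hlen, abs_of_nonneg (div_nonneg hT hnpos.le)]
  refine (norm_sum_le _ _).trans_lt ((Finset.sum_le_sum hstep).trans_lt ?_)
  rw [Finset.sum_const, Finset.card_range, nsmul_eq_mul]
  have : (n : ℝ) * (ε / (t - s + 1) * ((t - s) / n)) = ε * ((t - s) / (t - s + 1)) := by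
    field_simp
  rw [this]
  have h1 : (t - s) / (t - s + 1) < 1 := by rw [div_lt_one (by linarith)]; linarith
  nlinarith

section
open scoped Matrix.Norms.Operator

theorem continuous_exp_smul {N : ℕ} (F : Matrix (Fin N) (Fin N) ℝ) :
    Continuous fun u : ℝ => NormedSpace.exp (u • F) :=
  continuous_iff_continuousAt.2 fun u => (hasDerivAt_exp_smul_const (𝕂 := ℝ) F u).continuousAt

theorem hasDerivAt_exp_sub_mulVec {N : ℕ} (F : Matrix (Fin N) (Fin N) ℝ) (t u : ℝ)
    {h : ℝ → Fin N → ℝ} {h' : Fin N → ℝ} (hh : HasDerivAt h h' u) :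
    HasDerivAt (fun u => NormedSpace.exp ((t - u) • F) *ᵥ h u)
      (NormedSpace.exp ((t - u) • F) *ᵥ (h' - F *ᵥ h u)) u := by
  have hE : HasDerivAt (fun u : ℝ => NormedSpace.exp ((t - u) • F))
      (-(NormedSpace.exp ((t - u) • F) * F)) u := by
    have h1 := (hasDerivAt_exp_smul_const (𝕂 := ℝ) F (t - u)).scomp u
      ((hasDerivAt_id u).const_sub t)
    rw [neg_one_smul] at h1
    exact h1
  have hE' : ∀ i j, HasDerivAt (fun u : ℝ => NormedSpace.exp ((t - u) • F) i j)
      ((-(NormedSpace.exp ((t - u) • F) * F)) i j) u := fun i j =>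
    hasDerivAt_pi.1 (hasDerivAt_pi.1 hE i) j
  refine hasDerivAt_pi.2 fun i => ?_
  have h2 := HasDerivAt.fun_sum (u := Finset.univ) fun j _ =>
    (hE' i j).mul (hasDerivAt_pi.1 hh j)
  refine h2.congr_deriv ?_
  have e : NormedSpace.exp ((t - u) • F) *ᵥ (h' - F *ᵥ h u) =
      (-(NormedSpace.exp ((t - u) • F) * F)) *ᵥ h u + NormedSpace.exp ((t - u) • F) *ᵥ h' := by
    rw [Matrix.mulVec_sub, Matrix.mulVec_mulVec, Matrix.neg_mulVec]
    abel
  rw [e, Finset.sum_add_distrib]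
  rfl

end

/-- Variation of constants for `y(u) = y₀ + ∫₀ᵘ F y + b(u)` with a merely continuous forcing `b`:
integrate `exp ((t - u) F) h(u)` with `h = y - b`, which is differentiable. -/
theorem sub_exp_mulVec_eq {N : ℕ} (F : Matrix (Fin N) (Fin N) ℝ) {y b : ℝ → Fin N → ℝ}
    (hy : Continuous y) {y₀ : Fin N → ℝ}
    (h : ∀ u, 0 ≤ u → y u = y₀ + (∫ v in (0 : ℝ)..u, F *ᵥ y v) + b u) {s t : ℝ} (hs : 0 ≤ s)
    (hst : s ≤ t) :
    y t - NormedSpace.exp ((t - s) • F) *ᵥ y s =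
      b t - NormedSpace.exp ((t - s) • F) *ᵥ b s +
        ∫ u in s..t, NormedSpace.exp ((t - u) • F) *ᵥ (F *ᵥ b u) := by
  have hFy : Continuous fun v => F *ᵥ y v := continuous_const.matrix_mulVec hy
  set g : ℝ → Fin N → ℝ := fun u => y₀ + ∫ v in (0 : ℝ)..u, F *ᵥ y v with hg
  have hgd : ∀ u, HasDerivAt g (F *ᵥ y u) u := fun u =>
    (intervalIntegral.integral_hasDerivAt_right (hFy.intervalIntegrable _ _)
      (hFy.stronglyMeasurableAtFilter _ _) hFy.continuousAt).const_add y₀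
  have hgc : Continuous g := continuous_iff_continuousAt.2 fun u => (hgd u).continuousAt
  have hE : Continuous fun u : ℝ => NormedSpace.exp ((t - u) • F) :=
    (continuous_exp_smul F).comp (continuous_const.sub continuous_id)
  have hftc := intervalIntegral.integral_eq_sub_of_hasDerivAt (a := s) (b := t)
    (fun u _ => hasDerivAt_exp_sub_mulVec F t u (hgd u))
    ((hE.matrix_mulVec (hFy.sub (continuous_const.matrix_mulVec hgc))).intervalIntegrable _ _)
  have hcongr : ∫ u in s..t, NormedSpace.exp ((t - u) • F) *ᵥ (F *ᵥ y u - F *ᵥ g u) =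
      ∫ u in s..t, NormedSpace.exp ((t - u) • F) *ᵥ (F *ᵥ b u) := by
    refine intervalIntegral.integral_congr fun u hu => ?_
    rw [Set.uIcc_of_le hst] at hu
    have hu' : y u = g u + b u := h u (hs.trans hu.1)
    change NormedSpace.exp ((t - u) • F) *ᵥ (F *ᵥ y u - F *ᵥ g u) = _
    rw [← Matrix.mulVec_sub, hu', add_sub_cancel_left]
  have ht : y t = g t + b t := h t (hs.trans hst)
  have hs' : y s = g s + b s := h s hs
  rw [← hcongr, hftc, ht, hs', Matrix.mulVec_add, sub_self, zero_smul, NormedSpace.exp_zero,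
    Matrix.one_mulVec]
  abel

/-- The noise `y(t) - exp ((t - s) F) y(s)` accumulated over `[s, t]` is the limit of
Riemann-Stieltjes sums of `exp ((t - u) F)` against the forcing `b`, by summation by parts. -/
theorem tendsto_sum_exp_mulVec {N : ℕ} (F : Matrix (Fin N) (Fin N) ℝ) {y b : ℝ → Fin N → ℝ}
    (hy : Continuous y) (hb : Continuous b) {y₀ : Fin N → ℝ}
    (h : ∀ u, 0 ≤ u → y u = y₀ + (∫ v in (0 : ℝ)..u, F *ᵥ y v) + b u) {s t : ℝ} (hs : 0 ≤ s)
    (hst : s ≤ t) :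
    Tendsto (fun n : ℕ => ∑ k ∈ Finset.range n,
      NormedSpace.exp ((t - gridPoint s t n (k + 1 : ℕ)) • F) *ᵥ
        (b (gridPoint s t n (k + 1 : ℕ)) - b (gridPoint s t n k)))
      atTop (𝓝 (y t - NormedSpace.exp ((t - s) • F) *ᵥ y s)) := by
  have hE : Continuous fun u : ℝ => NormedSpace.exp ((t - u) • F) :=
    (continuous_exp_smul F).comp (continuous_const.sub continuous_id)
  have hΨ : Continuous (Function.uncurry fun v u : ℝ =>
      NormedSpace.exp ((t - u) • F) *ᵥ (F *ᵥ b v)) :=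
    (hE.comp continuous_snd).matrix_mulVec
      (continuous_const.matrix_mulVec (hb.comp continuous_fst))
  have hlim := tendsto_sum_integral_gridPoint hΨ hst le_rfl zero_le_one
  rw [sub_exp_mulVec_eq F hy h hs hst]
  refine (tendsto_const_nhds.add hlim).congr' ?_
  filter_upwards [eventually_ne_atTop 0] with n hn
  have hparts : ∀ k : ℕ, (∫ u in gridPoint s t n k..gridPoint s t n (k + 1 : ℕ),
      NormedSpace.exp ((t - u) • F) *ᵥ (F *ᵥ b (gridPoint s t n (k + 0)))) =
      NormedSpace.exp ((t - gridPoint s t n k) • F) *ᵥ b (gridPoint s t n k) -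
        NormedSpace.exp ((t - gridPoint s t n (k + 1 : ℕ)) • F) *ᵥ b (gridPoint s t n k) :=
    fun k => by
    have hftc := intervalIntegral.integral_eq_sub_of_hasDerivAt (a := gridPoint s t n k)
      (b := gridPoint s t n (k + 1 : ℕ))
      (fun u _ => hasDerivAt_exp_sub_mulVec F t u (hasDerivAt_const u (b (gridPoint s t n k))))
      ((hE.matrix_mulVec continuous_const).intervalIntegrable _ _)
    simp only [zero_sub, Matrix.mulVec_neg, intervalIntegral.integral_neg] at hftc
    rw [add_zero, ← neg_sub, ← hftc, neg_neg]
  have htel := Finset.sum_range_sub (fun k : ℕ =>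
    NormedSpace.exp ((t - gridPoint s t n k) • F) *ᵥ b (gridPoint s t n k)) n
  rw [Nat.cast_zero, gridPoint_zero, gridPoint_self s t hn, sub_self, zero_smul,
    NormedSpace.exp_zero, Matrix.one_mulVec] at htel
  rw [← htel, ← Finset.sum_add_distrib]
  refine Finset.sum_congr rfl fun k _ => ?_
  rw [hparts, Matrix.mulVec_sub]
  abel

end

/-! ### Independence of the noise from the past -/

section

open Filter Topology

section
variable {Ω : Type*} [MeasurableSpace Ω] {P : Measure Ω}

/-- Independence of `X` from `(Y, Z)` and of `Y` from `Z` gives independence of `Y` from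
`(X, Z)`. -/
theorem indepFun_prodMk_of_indepFun [IsProbabilityMeasure P] {α β γ : Type*} [MeasurableSpace α]
    [MeasurableSpace β] [MeasurableSpace γ] {X : Ω → α} {Y : Ω → β} {Z : Ω → γ}
    (hX : Measurable X) (hY : Measurable Y) (hZ : Measurable Z)
    (h₁ : IndepFun X (fun ω => (Y ω, Z ω)) P) (h₂ : IndepFun Y Z P) :
    IndepFun Y (fun ω => (X ω, Z ω)) P := by
  have hYZ := (indepFun_iff_map_prod_eq_prod_map_map hY.aemeasurable hZ.aemeasurable).1 h₂
  have hXYZ := (indepFun_iff_map_prod_eq_prod_map_map hX.aemeasurable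
    (hY.prodMk hZ).aemeasurable).1 h₁
  have hXZ : P.map (fun ω => (X ω, Z ω)) = (P.map X).prod (P.map Z) :=
    (indepFun_iff_map_prod_eq_prod_map_map hX.aemeasurable hZ.aemeasurable).1
      (h₁.comp measurable_id measurable_snd)
  have := Measure.isProbabilityMeasure_map (μ := P) hX.aemeasurable
  have := Measure.isProbabilityMeasure_map (μ := P) hY.aemeasurable
  have := Measure.isProbabilityMeasure_map (μ := P) hZ.aemeasurable
  rw [indepFun_iff_map_prod_eq_prod_map_map hY.aemeasurable (hX.prodMk hZ).aemeasurable, hXZ]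
  let φ : α × β × γ → β × α × γ := fun x => (x.2.1, x.1, x.2.2)
  have hφ : Measurable φ := by fun_prop
  have h3 : P.map (fun ω => (Y ω, X ω, Z ω)) = (P.map fun ω => (X ω, Y ω, Z ω)).map φ := by
    rw [Measure.map_map hφ (hX.prodMk (hY.prodMk hZ))]
    rfl
  rw [h3, hXYZ, hYZ, ← Measure.prodAssoc_prod, Measure.map_map hφ (by fun_prop),
    ← Measure.prodAssoc_prod (μ := P.map Y), ← Measure.prod_swap (μ := P.map X)]
  have h4 := Measure.map_prod_map ((P.map X).prod (P.map Y)) (P.map Z)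
    (measurable_swap (α := α) (β := β)) (measurable_id (α := γ))
  rw [Measure.map_id] at h4
  rw [h4, Measure.map_map (by fun_prop) (by fun_prop)]
  rfl

/-- An almost sure limit of measurable functions of `T` is almost surely a measurable function
of `T`. -/
theorem exists_measurable_ae_eq_comp_of_tendsto {α ι : Type*} [MeasurableSpace α]
    {T : Ω → α} {g : ℕ → α → ι → ℝ} (hg : ∀ n, Measurable (g n)) {h : Ω → ι → ℝ}
    (hlim : ∀ᵐ ω ∂P, Tendsto (fun n => g n (T ω)) atTop (𝓝 (h ω))) :
    ∃ G : α → ι → ℝ, Measurable G ∧ h =ᵐ[P] fun ω => G (T ω) := by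
  refine ⟨fun a i => limsup (fun n => g n a i) atTop, ?_, ?_⟩
  · exact measurable_pi_lambda _ fun i => Measurable.limsup fun n => (measurable_pi_iff.1 (hg n)) i
  · filter_upwards [hlim] with ω hω
    funext i
    exact ((tendsto_pi_nhds.1 hω i).limsup_eq).symm

/-- The weak Markov property of a vector-valued Brownian motion: the increments after time `s` are
independent of the path up to time `s`. -/
theorem IsBrownianVector.indepFun_shift [IsProbabilityMeasure P] {M : ℕ}
    {W : ℝ≥0 → Ω → Fin M → ℝ} (hW : IsBrownianVector W P) (s : ℝ≥0) :
    IndepFun (fun ω (v : ℝ≥0) => W (s + v) ω - W s ω) (fun ω (v : Set.Iic s) => W v ω) P := by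
  have hm : ∀ t i, Measurable fun ω => W t ω i := fun t i =>
    measurable_pi_iff.1 (hW.measurable t) i
  -- `(Z i, V i)` is independent over `i`, and within each pair: the joint law is a product
  -- of pairs, hence, after regrouping, the product of the laws of `Z` and `V`
  let Z : Fin M → Ω → ℝ≥0 → ℝ := fun i ω v => W (s + v) ω i - W s ω i
  let V : Fin M → Ω → Set.Iic s → ℝ := fun i ω v => W v ω i
  have hZ : ∀ i, Measurable (Z i) := fun i =>
    measurable_pi_lambda _ fun v => (hm _ i).sub (hm _ i)
  have hV : ∀ i, Measurable (V i) := fun i => measurable_pi_lambda _ fun v => hm _ i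
  have hT : iIndepFun (fun i ω => (Z i ω, V i ω)) P :=
    hW.indep.comp (fun i w => ((fun v => w (s + v) - w s : ℝ≥0 → ℝ), fun v : Set.Iic s => w v))
      (fun i => by
        refine Measurable.prodMk (measurable_pi_lambda _ fun v => ?_)
          (measurable_pi_lambda _ fun v => ?_)
        · exact (measurable_pi_apply _).sub (measurable_pi_apply _)
        · exact measurable_pi_apply _)
  have hTZ : iIndepFun Z P := hT.comp (fun i x => x.1) (fun i => measurable_fst)
  have hTV : iIndepFun V P := hT.comp (fun i x => x.2) (fun i => measurable_snd)
  have hpair : ∀ i, P.map (fun ω => (Z i ω, V i ω)) = (P.map (Z i)).prod (P.map (V i)) := fun i =>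
    (indepFun_iff_map_prod_eq_prod_map_map (hZ i).aemeasurable (hV i).aemeasurable).1
      ((hW.coord i).toIsPreBrownianReal.indepFun_shift s)
  have hpZ := fun i => Measure.isProbabilityMeasure_map (μ := P) (hZ i).aemeasurable
  have hpV := fun i => Measure.isProbabilityMeasure_map (μ := P) (hV i).aemeasurable
  have hlaw := (iIndepFun_iff_map_fun_eq_pi_map
    (fun i => ((hZ i).prodMk (hV i)).aemeasurable)).1 hT
  have hlawZ := (iIndepFun_iff_map_fun_eq_pi_map (fun i => (hZ i).aemeasurable)).1 hTZ
  have hlawV := (iIndepFun_iff_map_fun_eq_pi_map (fun i => (hV i).aemeasurable)).1 hTV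
  have hind : IndepFun (fun ω i => Z i ω) (fun ω i => V i ω) P := by
    rw [indepFun_iff_map_prod_eq_prod_map_map (measurable_pi_lambda _ hZ).aemeasurable
      (measurable_pi_lambda _ hV).aemeasurable, hlawZ, hlawV,
      ← (measurePreserving_arrowProdEquivProdArrow _ _ _ _ _).map_eq]
    simp only [← hpair]
    rw [← hlaw, Measure.map_map (MeasurableEquiv.measurable _)
      (measurable_pi_lambda _ fun i => (hZ i).prodMk (hV i))]
    rfl
  exact hind.comp (φ := fun z v i => z i v) (ψ := fun z v i => z i v)
    (measurable_pi_lambda _ fun v => measurable_pi_lambda _ fun i =>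
      (measurable_pi_apply v).comp (measurable_pi_apply i))
    (measurable_pi_lambda _ fun v => measurable_pi_lambda _ fun i =>
      (measurable_pi_apply v).comp (measurable_pi_apply i))

theorem IsBrownianVector.continuous {M : ℕ} {W : ℝ≥0 → Ω → Fin M → ℝ}
    (hW : IsBrownianVector W P) : ∀ᵐ ω ∂P, Continuous fun t => W t ω := by
  filter_upwards [ae_all_iff.2 fun i => (hW.coord i).cont] with ω hω using continuous_pi hω

/-- The Riemann sums of the Wiener integral `∫ exp ((t - u) F) L dw(u)` over `[s, t]`. -/
def noiseSum {N M : ℕ} (F : Matrix (Fin N) (Fin N) ℝ) (L : Matrix (Fin N) (Fin M) ℝ) (s t : ℝ)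
    (n : ℕ) (w : ℝ≥0 → Fin M → ℝ) : Fin N → ℝ :=
  ∑ k ∈ Finset.range n, (NormedSpace.exp ((t - gridPoint s t n (k + 1 : ℕ)) • F) * L) *ᵥ
    (w (gridPoint s t n (k + 1 : ℕ)).toNNReal - w (gridPoint s t n k).toNNReal)

theorem measurable_noiseSum {N M : ℕ} (F : Matrix (Fin N) (Fin N) ℝ)
    (L : Matrix (Fin N) (Fin M) ℝ) (s t : ℝ) (n : ℕ) : Measurable (noiseSum F L s t n) := by
  refine Finset.measurable_sum _ fun k _ => ?_
  have h : ∀ v : ℝ≥0, Measurable fun w : ℝ≥0 → Fin M → ℝ => w v := measurable_pi_apply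
  exact (Continuous.matrix_mulVec continuous_const continuous_id).measurable.comp
    ((h _).sub (h _))

/-- `noiseSum` depends only on the increments of the path over `[s, t]`. -/
theorem noiseSum_congr {N M : ℕ} (F : Matrix (Fin N) (Fin N) ℝ)
    (L : Matrix (Fin N) (Fin M) ℝ) {s t : ℝ} (hst : s ≤ t) (n : ℕ)
    {w w' : ℝ≥0 → Fin M → ℝ} (c : Fin M → ℝ)
    (h : ∀ u ∈ Set.Icc s t, w u.toNNReal = w' u.toNNReal + c) :
    noiseSum F L s t n w = noiseSum F L s t n w' := by
  refine Finset.sum_congr rfl fun k hk => ?_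
  have hk : k < n := Finset.mem_range.1 hk
  have hn : n ≠ 0 := by omega
  have hk1 : ((k + 1 : ℕ) : ℝ) ≤ n := by exact_mod_cast hk
  rw [h _ (gridPoint_mem_Icc hst hn (k + 1 : ℕ).cast_nonneg hk1),
    h _ (gridPoint_mem_Icc hst hn k.cast_nonneg (by push_cast at hk1; linarith)),
    add_sub_add_right_eq_sub]

/-- Along almost every path the noise `f(t) - exp ((t - s) F) f(s)` is the limit of the Riemann
sums of the Wiener integral. -/
theorem IsSolution.tendsto_noiseSum {N M : ℕ} {F : Matrix (Fin N) (Fin N) ℝ}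
    {L : Matrix (Fin N) (Fin M) ℝ} {W : ℝ≥0 → Ω → Fin M → ℝ} {f : ℝ≥0 → Ω → Fin N → ℝ}
    (hf : IsSolution F L W f P) (hW : IsBrownianVector W P) :
    ∀ᵐ ω ∂P, ∀ s t : ℝ≥0, s ≤ t →
      Tendsto (fun n => noiseSum F L s t n fun v => W v ω) atTop
        (𝓝 (f t ω - NormedSpace.exp (((t : ℝ) - s) • F) *ᵥ f s ω)) := by
  filter_upwards [hf.continuous, hf.eq, hW.continuous] with ω hc heq hWc s t hst
  have hy : Continuous fun u : ℝ => f u.toNNReal ω := hc.comp continuous_real_toNNReal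
  have hb : Continuous fun u : ℝ => L *ᵥ W u.toNNReal ω :=
    continuous_const.matrix_mulVec (hWc.comp continuous_real_toNNReal)
  have h : ∀ u : ℝ, 0 ≤ u → f u.toNNReal ω =
      f 0 ω + (∫ v in (0 : ℝ)..u, F *ᵥ f v.toNNReal ω) + L *ᵥ W u.toNNReal ω := fun u hu => by
    have := heq u.toNNReal
    rwa [Real.coe_toNNReal u hu] at this
  have := tendsto_sum_exp_mulVec F hy hb h s.coe_nonneg (NNReal.coe_le_coe.2 hst)
  simp only [Real.toNNReal_coe] at this
  refine this.congr fun n => Finset.sum_congr rfl fun k _ => ?_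
  rw [← Matrix.mulVec_sub, Matrix.mulVec_mulVec]

/-- The noise accumulated over `[s, t]` is independent of the solution up to time `s`. -/
theorem IsSolution.indepFun_noise [IsProbabilityMeasure P] {N M : ℕ}
    {F : Matrix (Fin N) (Fin N) ℝ}
    {L : Matrix (Fin N) (Fin M) ℝ} {W : ℝ≥0 → Ω → Fin M → ℝ} {f : ℝ≥0 → Ω → Fin N → ℝ}
    (hf : IsSolution F L W f P) (hW : IsBrownianVector W P) {s t : ℝ≥0} (hst : s ≤ t) :
    IndepFun (fun ω => f t ω - NormedSpace.exp (((t : ℝ) - s) • F) *ᵥ f s ω)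
      (fun ω (u : Set.Iic s) => f u ω) P := by
  let Z : Ω → ℝ≥0 → Fin M → ℝ := fun ω v => W (s + v) ω - W s ω
  let V : Ω → Set.Iic s → Fin M → ℝ := fun ω v => W v ω
  have hZ : Measurable Z :=
    measurable_pi_lambda _ fun v => (hW.measurable _).sub (hW.measurable _)
  have hV : Measurable V := measurable_pi_lambda _ fun v => hW.measurable _
  have hsplit : Measurable fun w : ℝ≥0 → Fin M → ℝ =>
      ((fun v => w (s + v) - w s : ℝ≥0 → Fin M → ℝ), fun v : Set.Iic s => w v) := by
    refine Measurable.prodMk (measurable_pi_lambda _ fun v => ?_)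
      (measurable_pi_lambda _ fun v => ?_)
    · exact (measurable_pi_apply _).sub (measurable_pi_apply _)
    · exact measurable_pi_apply _
  have hind : IndepFun Z (fun ω => (f 0 ω, V ω)) P :=
    indepFun_prodMk_of_indepFun (hf.measurable 0) hZ hV
      (hf.indep_init.comp measurable_id hsplit) (hW.indepFun_shift s)
  -- the noise is a function of the increments after `s`
  obtain ⟨G, hG, hGη⟩ := exists_measurable_ae_eq_comp_of_tendsto (P := P) (T := Z)
    (g := fun n z => noiseSum F L s t n fun v => z (v - s))
    (fun n => (measurable_noiseSum F L s t n).comp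
      (measurable_pi_lambda _ fun v => measurable_pi_apply _))
    (h := fun ω => f t ω - NormedSpace.exp (((t : ℝ) - s) • F) *ᵥ f s ω) (by
      filter_upwards [hf.tendsto_noiseSum hW] with ω hω
      refine (hω s t hst).congr fun n => noiseSum_congr F L (NNReal.coe_le_coe.2 hst) n (W s ω)
        fun u hu => ?_
      have : s ≤ u.toNNReal := NNReal.le_toNNReal_of_coe_le hu.1
      simp only [Z]
      rw [add_tsub_cancel_of_le this, sub_add_cancel])
  -- the solution at time `u ≤ s` is a function of its initial value and of `W` up to time `s`
  have hpast : ∀ u : Set.Iic s, ∃ H : (Fin N → ℝ) × (Set.Iic s → Fin M → ℝ) → Fin N → ℝ,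
      Measurable H ∧ (fun ω => f u ω) =ᵐ[P] fun ω => H (f 0 ω, V ω) := fun u => by
    obtain ⟨H, hH, hHf⟩ := exists_measurable_ae_eq_comp_of_tendsto (P := P) (T := V)
      (g := fun n z => noiseSum F L (0 : ℝ≥0) (u : ℝ≥0) n fun v => z ⟨min v s, Set.mem_Iic.2 (min_le_right v s)⟩)
      (fun n => (measurable_noiseSum F L _ _ n).comp
        (measurable_pi_lambda _ fun v =>
          measurable_pi_apply (⟨min v s, Set.mem_Iic.2 (min_le_right v s)⟩ : Set.Iic s)))
      (h := fun ω => f u ω - NormedSpace.exp ((((u : ℝ≥0) : ℝ) - (0 : ℝ≥0)) • F) *ᵥ f 0 ω) (by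
        filter_upwards [hf.tendsto_noiseSum hW] with ω hω
        refine (hω 0 u zero_le).congr fun n =>
          noiseSum_congr F L (NNReal.coe_le_coe.2 zero_le) n 0 fun v hv => ?_
        have : v.toNNReal ≤ s := (Real.toNNReal_le_iff_le_coe.2 hv.2).trans u.2
        simp only [V]
        rw [add_zero, min_eq_left this])
    refine ⟨fun x => H x.2 + NormedSpace.exp ((((u : ℝ≥0) : ℝ) - (0 : ℝ≥0)) • F) *ᵥ x.1,
      (hH.comp measurable_snd).add
        ((Continuous.matrix_mulVec continuous_const continuous_id).measurable.comp
          measurable_fst), ?_⟩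
    filter_upwards [hHf] with ω hω
    rw [← hω, sub_add_cancel]
  choose H hH hHf using hpast
  have h1 : IndepFun (fun ω => G (Z ω)) (fun ω (u : Set.Iic s) => H u (f 0 ω, V ω)) P :=
    hind.comp hG (measurable_pi_lambda _ hH)
  exact (h1.process_congr_right fun u => (hHf u).symm).congr hGη.symm .rfl

end

end

/-! ### The law of the noise -/

section

open Filter Topology

/-- The quadratic form of the integrand of `noiseCov` is the squared norm of the row vector
`v exp (u F) L`. -/
theorem dotProduct_integrand_mulVec {N M : ℕ} (G : Matrix (Fin N) (Fin N) ℝ)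
    (L : Matrix (Fin N) (Fin M) ℝ) (v : Fin N → ℝ) :
    v ⬝ᵥ ((G * L * Lᵀ * Gᵀ) *ᵥ v) = ∑ j, (v ᵥ* (G * L)) j ^ 2 := by
  have h : G * L * Lᵀ * Gᵀ = (G * L) * (G * L)ᵀ := by
    rw [Matrix.transpose_mul, Matrix.mul_assoc]
  rw [h, ← Matrix.mulVec_mulVec, Matrix.dotProduct_mulVec, Matrix.mulVec_transpose, dotProduct]
  exact Finset.sum_congr rfl fun j _ => (sq _).symm

theorem continuous_noiseCov_integrand {N M : ℕ} (F : Matrix (Fin N) (Fin N) ℝ)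
    (L : Matrix (Fin N) (Fin M) ℝ) :
    Continuous fun u : ℝ => NormedSpace.exp (u • F) * L * Lᵀ * (NormedSpace.exp (u • F))ᵀ :=
  (((continuous_exp_smul F).matrix_mul continuous_const).matrix_mul continuous_const).matrix_mul
    (continuous_exp_smul F).matrix_transpose

theorem dotProduct_noiseCov_mulVec {N M : ℕ} (F : Matrix (Fin N) (Fin N) ℝ)
    (L : Matrix (Fin N) (Fin M) ℝ) (τ : ℝ) (v : Fin N → ℝ) :
    v ⬝ᵥ (noiseCov F L τ *ᵥ v) =
      ∫ u in (0 : ℝ)..τ, ∑ j, (v ᵥ* (NormedSpace.exp (u • F) * L)) j ^ 2 := by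
  have key : ∀ m : Fin N → Fin N → ℝ → ℝ, (∀ i j, Continuous (m i j)) →
      ∑ i, v i * ∑ j, (∫ u in (0 : ℝ)..τ, m i j u) * v j =
        ∫ u in (0 : ℝ)..τ, ∑ i, v i * ∑ j, m i j u * v j := fun m hm => by
    rw [intervalIntegral.integral_finsetSum]
    · refine Finset.sum_congr rfl fun i _ => ?_
      rw [intervalIntegral.integral_const_mul, intervalIntegral.integral_finsetSum]
      · simp only [intervalIntegral.integral_mul_const]
      · exact fun j _ => Continuous.intervalIntegrable (by fun_prop) _ _
    · exact fun i _ => Continuous.intervalIntegrable (by fun_prop) _ _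
  simp only [← dotProduct_integrand_mulVec]
  exact key _ fun i j => (continuous_noiseCov_integrand F L).matrix_elem i j

theorem posSemidef_noiseCov {N M : ℕ} (F : Matrix (Fin N) (Fin N) ℝ)
    (L : Matrix (Fin N) (Fin M) ℝ) {τ : ℝ} (hτ : 0 ≤ τ) : (noiseCov F L τ).PosSemidef := by
  refine Matrix.PosSemidef.of_dotProduct_mulVec_nonneg ?_ fun v => ?_
  · ext i j
    rw [Matrix.conjTranspose_apply, star_trivial, noiseCov, Matrix.of_apply, Matrix.of_apply]
    congr 1
    funext u
    rw [← Matrix.transpose_apply (_ * _ * _ * _)]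
    simp only [Matrix.transpose_mul, Matrix.transpose_transpose, Matrix.mul_assoc]
  · rw [star_trivial, dotProduct_noiseCov_mulVec]
    exact intervalIntegral.integral_nonneg hτ fun u _ => Finset.sum_nonneg fun j _ => sq_nonneg _

section
variable {Ω : Type*} [MeasurableSpace Ω] {P : Measure Ω}

/-- The characteristic function of a linear combination of the increments of a Brownian motion
over consecutive intervals. -/
theorem charFun_map_sum_increments [IsProbabilityMeasure P] {B : ℝ≥0 → Ω → ℝ}
    (hB : IsPreBrownianReal B P) {t : ℕ → ℝ≥0} (ht : Monotone t) (a : ℕ → ℝ) (n : ℕ) :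
    charFun (P.map fun ω => ∑ k ∈ Finset.range n, a k * (B (t (k + 1)) ω - B (t k) ω)) 1 =
      Complex.exp (-((∑ k ∈ Finset.range n, a k ^ 2 * ((t (k + 1) : ℝ) - t k) : ℝ) : ℂ) / 2) := by
  have hind : iIndepFun (fun k ω => a k * (B (t (k + 1)) ω - B (t k) ω)) P :=
    (hB.hasIndepIncrements.nat ht).comp (fun k x => a k * x) fun k => measurable_const_mul _
  have hm : ∀ k, AEMeasurable (fun ω => a k * (B (t (k + 1)) ω - B (t k) ω)) P := fun k =>
    ((hB.aemeasurable _).sub (hB.aemeasurable _)).const_mul _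
  rw [iIndepFun.charFun_map_fun_finsetSum_eq_prod (fun k _ => hm k)
    (hind.precomp (g := fun k : Finset.range n => (k : ℕ)) Subtype.val_injective),
    Finset.prod_apply]
  have h1 : ∀ k, charFun (P.map fun ω => a k * (B (t (k + 1)) ω - B (t k) ω)) 1 =
      Complex.exp (-((a k ^ 2 * ((t (k + 1) : ℝ) - t k) : ℝ) : ℂ) / 2) := fun k => by
    have hk : t k ≤ t (k + 1) := ht k.le_succ
    have hd : nndist (t (k + 1) : ℝ) (t k : ℝ) = t (k + 1) - t k := by
      refine NNReal.eq ?_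
      rw [coe_nndist, Real.dist_eq, NNReal.coe_sub hk, abs_of_nonneg]
      exact sub_nonneg.2 (NNReal.coe_le_coe.2 hk)
    have hlaw₀ : HasLaw (B (t (k + 1)) - B (t k)) (gaussianReal 0 (t (k + 1) - t k)) P := by
      rw [← hd]
      exact hB.hasLaw_sub _ _
    have hlaw := gaussianReal_const_mul hlaw₀ (a k)
    simp only [Pi.sub_apply] at hlaw
    rw [hlaw.map_eq, charFun_gaussianReal, NNReal.coe_mul, NNReal.coe_sub hk]
    congr 1
    simp
    ring
  simp only [h1]
  rw [← Complex.exp_sum]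
  congr 1
  push_cast
  rw [← Finset.sum_div, Finset.sum_neg_distrib]

/-- The characteristic function of a Riemann sum of the Wiener integral: its projection on `v` is a
sum over the independent coordinates of `W` of linear combinations of increments. -/
theorem integral_exp_noiseSum [IsProbabilityMeasure P] {N M : ℕ} (F : Matrix (Fin N) (Fin N) ℝ)
    (L : Matrix (Fin N) (Fin M) ℝ) {W : ℝ≥0 → Ω → Fin M → ℝ} (hW : IsBrownianVector W P)
    {s t : ℝ} (hs : 0 ≤ s) (hst : s ≤ t) (n : ℕ) (v : Fin N → ℝ) :
    ∫ ω, Complex.exp (((v ⬝ᵥ noiseSum F L s t n fun u => W u ω : ℝ) : ℂ) * Complex.I) ∂P =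
      Complex.exp (-((∑ k ∈ Finset.range n, (∑ j, (v ᵥ* (NormedSpace.exp
        ((t - gridPoint s t n (k + 1 : ℕ)) • F) * L)) j ^ 2) *
          (gridPoint s t n (k + 1 : ℕ) - gridPoint s t n k) : ℝ) : ℂ) / 2) := by
  let a : Fin M → ℕ → ℝ := fun j k =>
    (v ᵥ* (NormedSpace.exp ((t - gridPoint s t n (k + 1 : ℕ)) • F) * L)) j
  let g : ℕ → ℝ≥0 := fun k => (gridPoint s t n k).toNNReal
  have hg : Monotone g := fun k l hkl =>
    Real.toNNReal_mono (gridPoint_mono hst n (by exact_mod_cast hkl))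
  have hgc : ∀ k : ℕ, (g k : ℝ) = gridPoint s t n k := fun k => by
    refine Real.coe_toNNReal _ (hs.trans ?_)
    have := gridPoint_mono hst n (k.cast_nonneg (α := ℝ))
    rwa [gridPoint_zero] at this
  let R : Fin M → Ω → ℝ := fun j ω =>
    ∑ k ∈ Finset.range n, a j k * (W (g (k + 1)) ω j - W (g k) ω j)
  have hm : ∀ u j, Measurable fun ω => W u ω j := fun u j =>
    measurable_pi_iff.1 (hW.measurable u) j
  have hR : ∀ j, Measurable (R j) := fun j =>
    Finset.measurable_fun_sum _ fun k _ => ((hm _ j).sub (hm _ j)).const_mul _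
  have heval : ∀ u : ℝ≥0, Measurable fun w : ℝ≥0 → ℝ => w u := measurable_pi_apply
  have hRind : iIndepFun R P :=
    hW.indep.comp (fun j w => ∑ k ∈ Finset.range n, a j k * (w (g (k + 1)) - w (g k))) fun j =>
      Finset.measurable_fun_sum _ fun k _ =>
        ((heval _).sub (heval _)).const_mul _
  have hdot : ∀ ω, v ⬝ᵥ noiseSum F L s t n (fun u => W u ω) = ∑ j, R j ω := fun ω => by
    simp only [noiseSum, R]
    rw [dotProduct_sum, Finset.sum_comm]
    refine Finset.sum_congr rfl fun k _ => ?_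
    rw [Matrix.dotProduct_mulVec, dotProduct]
    rfl
  have hchar : ∫ ω, Complex.exp (((v ⬝ᵥ noiseSum F L s t n fun u => W u ω : ℝ) : ℂ) * Complex.I) ∂P
      = charFun (P.map fun ω => ∑ j, R j ω) 1 := by
    rw [charFun_apply_real, integral_map (Finset.measurable_fun_sum _ fun j _ => hR j).aemeasurable
      (by fun_prop)]
    simp only [hdot, Complex.ofReal_one, one_mul]
  rw [hchar, iIndepFun.charFun_map_fun_finsetSum_eq_prod (fun j _ => (hR j).aemeasurable)
    (hRind.precomp (g := fun j : (Finset.univ : Finset (Fin M)) => (j : Fin M))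
      Subtype.val_injective), Finset.prod_apply]
  have h1 : ∀ j, charFun (P.map (R j)) 1 = Complex.exp (-((∑ k ∈ Finset.range n,
      a j k ^ 2 * (gridPoint s t n (k + 1 : ℕ) - gridPoint s t n k) : ℝ) : ℂ) / 2) := fun j => by
    simp only [← hgc]
    exact charFun_map_sum_increments (hW.coord j).toIsPreBrownianReal hg (a j) n
  simp only [h1]
  rw [← Complex.exp_sum, ← Finset.sum_div, Finset.sum_neg_distrib, ← Complex.ofReal_sum,
    Finset.sum_comm]
  simp only [Finset.sum_mul]
  rfl

/-- The variances of the Riemann sums of the Wiener integral converge to the quadratic form of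
`noiseCov`. -/
theorem tendsto_sum_noise_variance {N M : ℕ} (F : Matrix (Fin N) (Fin N) ℝ)
    (L : Matrix (Fin N) (Fin M) ℝ) {s t : ℝ} (hst : s ≤ t) (v : Fin N → ℝ) :
    Tendsto (fun n : ℕ => ∑ k ∈ Finset.range n, (∑ j, (v ᵥ* (NormedSpace.exp
        ((t - gridPoint s t n (k + 1 : ℕ)) • F) * L)) j ^ 2) *
          (gridPoint s t n (k + 1 : ℕ) - gridPoint s t n k)) atTop
      (𝓝 (v ⬝ᵥ (noiseCov F L (t - s) *ᵥ v))) := by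
  let q : ℝ → ℝ := fun u => ∑ j, (v ᵥ* (NormedSpace.exp (u • F) * L)) j ^ 2
  have hq : Continuous q := continuous_finsetSum _ fun j _ =>
    ((continuous_apply j).comp (continuous_const.matrix_vecMul
      ((continuous_exp_smul F).matrix_mul continuous_const))).pow 2
  have hΨ : Continuous (Function.uncurry fun x _ : ℝ => q (t - x)) :=
    hq.comp (continuous_const.sub continuous_fst)
  have hlim := tendsto_sum_integral_gridPoint hΨ hst zero_le_one le_rfl
  have hint : ∫ u in s..t, q (t - u) = v ⬝ᵥ (noiseCov F L (t - s) *ᵥ v) := by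
    rw [intervalIntegral.integral_comp_sub_left q t, sub_self, dotProduct_noiseCov_mulVec]
  rw [hint] at hlim
  refine hlim.congr fun n => Finset.sum_congr rfl fun k _ => ?_
  rw [intervalIntegral.integral_const, smul_eq_mul, mul_comm, Nat.cast_succ]

/-- The noise accumulated over `[s, t]` is Gaussian: its characteristic function is the limit of
those of the Riemann sums of the Wiener integral. -/
theorem IsSolution.hasLaw_noise [IsProbabilityMeasure P] {N M : ℕ} {F : Matrix (Fin N) (Fin N) ℝ}
    {L : Matrix (Fin N) (Fin M) ℝ} {W : ℝ≥0 → Ω → Fin M → ℝ} {f : ℝ≥0 → Ω → Fin N → ℝ}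
    (hf : IsSolution F L W f P) (hW : IsBrownianVector W P) {s t : ℝ≥0} (hst : s ≤ t) :
    HasLaw (fun ω => WithLp.toLp 2
        (f t ω - NormedSpace.exp (((t : ℝ) - s) • F) *ᵥ f s ω))
      (multivariateGaussian 0 (noiseCov F L ((t : ℝ) - s))) P := by
  have hst' : (s : ℝ) ≤ t := NNReal.coe_le_coe.2 hst
  set η : Ω → Fin N → ℝ := fun ω => f t ω - NormedSpace.exp (((t : ℝ) - s) • F) *ᵥ f s ω with hη
  have hηm : Measurable η := (hf.measurable t).sub
    ((Continuous.matrix_mulVec continuous_const continuous_id).measurable.comp (hf.measurable s))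
  have hηm' : Measurable fun ω => WithLp.toLp 2 (η ω) :=
    (WithLp.measurable_toLp 2 (Fin N → ℝ)).comp hηm
  refine ⟨hηm'.aemeasurable, ?_⟩
  have := Measure.isProbabilityMeasure_map (μ := P) hηm'.aemeasurable
  refine Measure.ext_of_charFun (funext fun v => ?_)
  rw [charFun_multivariateGaussian (posSemidef_noiseCov F L (sub_nonneg.2 hst')), inner_zero_right,
    Complex.ofReal_zero, zero_mul, zero_sub, charFun_apply,
    integral_map hηm'.aemeasurable (by fun_prop)]
  have hinner : ∀ ω, inner ℝ (WithLp.toLp 2 (η ω)) v = v.ofLp ⬝ᵥ η ω := fun ω => by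
    rw [EuclideanSpace.inner_eq_star_dotProduct, star_trivial]
  simp only [hinner]
  have hlim : Tendsto (fun n => ∫ ω, Complex.exp
      (((v.ofLp ⬝ᵥ noiseSum F L s t n fun u => W u ω : ℝ) : ℂ) * Complex.I) ∂P) atTop
      (𝓝 (∫ ω, Complex.exp (((v.ofLp ⬝ᵥ η ω : ℝ) : ℂ) * Complex.I) ∂P)) := by
    have hc : Continuous fun x : Fin N → ℝ =>
        Complex.exp (((v.ofLp ⬝ᵥ x : ℝ) : ℂ) * Complex.I) := by fun_prop
    refine tendsto_integral_of_dominated_convergence (fun _ => 1) (fun n => ?_)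
      (integrable_const _) (fun n => ?_) ?_
    · exact (hc.measurable.comp ((measurable_noiseSum F L s t n).comp
        (measurable_pi_lambda _ hW.measurable))).aestronglyMeasurable
    · exact ae_of_all _ fun ω => (Complex.norm_exp_ofReal_mul_I _).le
    · filter_upwards [hf.tendsto_noiseSum hW] with ω hω
      exact (hc.tendsto _).comp (hω s t hst)
  refine tendsto_nhds_unique hlim ?_
  simp only [integral_exp_noiseSum F L hW s.coe_nonneg hst']
  rw [← neg_div]
  refine (Complex.continuous_exp.tendsto _).comp (Tendsto.div_const (Tendsto.neg ?_) 2)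
  exact (Complex.continuous_ofReal.tendsto _).comp (tendsto_sum_noise_variance F L hst' v.ofLp)

end

section
open scoped Matrix.Norms.Operator

theorem toComplex_exp_smul {N : ℕ} (F : Matrix (Fin N) (Fin N) ℝ) (τ : ℝ) :
    toComplex (NormedSpace.exp (τ • F)) = NormedSpace.exp ((τ : ℂ) • toComplex F) := by
  have hc : Continuous (Complex.ofRealHom.mapMatrix : Matrix (Fin N) (Fin N) ℝ →+* _) :=
    continuous_id.matrix_map Complex.continuous_ofReal
  have h : (τ : ℂ) • toComplex F = Complex.ofRealHom.mapMatrix (τ • F) := by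
    ext i j
    simp [toComplex]
  rw [h]
  exact NormedSpace.map_exp _ hc _

end

theorem vecToComplex_mulVec {N : ℕ} (A : Matrix (Fin N) (Fin N) ℝ) (v : Fin N → ℝ) :
    vecToComplex (A *ᵥ v) = toComplex A *ᵥ vecToComplex v :=
  funext fun i => RingHom.map_mulVec Complex.ofRealHom A v i

theorem Mixture.IsCoordinateChange.followsSSM {N M : ℕ} {F : Matrix (Fin N) (Fin N) ℝ}
    {L : Matrix (Fin N) (Fin M) ℝ} {K : Mixture} {X : Matrix (Fin N) K.State ℂ}
    {Y : Matrix K.State (Fin N) ℂ} (hXY : K.IsCoordinateChange F X Y) {Ω : Type*}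
    [MeasurableSpace Ω] {P : Measure Ω} [IsProbabilityMeasure P] {W : ℝ≥0 → Ω → Fin M → ℝ}
    {f : ℝ≥0 → Ω → Fin N → ℝ} (hW : IsBrownianVector W P) (hf : IsSolution F L W f P) :
    FollowsSSM K.transition (noiseCov F L) Y f P := by
  intro s t hst
  have hτ : 0 ≤ (t : ℝ) - s := sub_nonneg.2 (NNReal.coe_le_coe.2 hst)
  refine ⟨fun ω => f t ω - NormedSpace.exp (((t : ℝ) - s) • F) *ᵥ f s ω, fun ω => ?_,
    hf.indepFun_noise hW hst, posSemidef_noiseCov F L hτ, hf.hasLaw_noise hW hst⟩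
  have h1 : K.transition ((t : ℝ) - s) * Y =
      Y * toComplex (NormedSpace.exp (((t : ℝ) - s) • F)) := by
    rw [toComplex_exp_smul, hXY.2.2 _ hτ, ← Matrix.mul_assoc, ← Matrix.mul_assoc, hXY.2.1,
      Matrix.one_mul]
  rw [Matrix.mulVec_mulVec, h1, ← Matrix.mulVec_mulVec, ← vecToComplex_mulVec, ← Matrix.mulVec_add]
  congr 1
  funext i
  simp [vecToComplex]

end

end HidaMatern

end

open HidaMatern in
theorem lemma5p1 {N M : ℕ} (F : Matrix (Fin N) (Fin N) ℝ) (L : Matrix (Fin N) (Fin M) ℝ)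
    (hF : IsStable F) :
    (∃ B : JordanData, IsJordanForm F B) ∧
    ∀ B : JordanData, IsJordanForm F B →
      (∃ K : Mixture, K.Matches B) ∧
      ∀ K : Mixture,
        (K.Matches B ↔ ∃ (X : Matrix (Fin N) K.State ℂ) (Y : Matrix K.State (Fin N) ℂ),
          K.IsCoordinateChange F X Y) ∧
        (K.Matches B →
          ∑ i, K.order i = N ∧ (∀ τ : ℝ, 0 ≤ τ → IsUnit (K.cov τ).det)) ∧
        ∀ (X : Matrix (Fin N) K.State ℂ) (Y : Matrix K.State (Fin N) ℂ),
          K.IsCoordinateChange F X Y →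
          ∀ {Ω : Type*} [MeasurableSpace Ω] (P : Measure Ω) [IsProbabilityMeasure P]
            (W : ℝ≥0 → Ω → Fin M → ℝ) (f : ℝ≥0 → Ω → Fin N → ℝ),
            IsBrownianVector W P → IsSolution F L W f P →
            FollowsSSM K.transition (noiseCov F L) Y f P := by
  refine ⟨exists_isJordanForm F, fun B hB => ⟨hB.exists_matches hF, fun K => ⟨⟨?_, ?_⟩, ?_, ?_⟩⟩⟩
  · exact fun h => h.exists_isCoordinateChange hB
  · exact fun ⟨X, Y, h⟩ => h.matches hB
  · exact fun h => ⟨h.sum_order hB, fun τ hτ => K.isUnit_det_cov hτ⟩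
  · exact fun X Y h Ω _ P _ W f hW hf => h.followsSSM hW hf
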